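/- **Model.** The ring has $n$ anonymous nodes $v_0,\dots,v_{n-1}$ and links $\{v_i,v_{i+1}\}$ (indices mod $n$). In each synchronous round at most one link is missing, chosen by an adversary. There are $k\le n$ agents with distinct identifiers (natural numbers), starting at mutually distinct nodes, which agree on the orientation of the ring and know $n$, $k$ and $g$. Each node carries a whiteboard, whose initial content only shows whether an agent starts there. Each agent is a deterministic finite automaton (finite as soon as the identifiers come from a finite set) that may depend on its own identifier. In every round each agent takes one atomic action (agents at the same node act one after the other, in an arbitrary order): it reads the whiteboard of its node, changes its state, rewrites the whiteboard, and stays or tries to move forward or backward; if the link is missing it remains where it is. An agent sees nothing else; in its final state it does nothing, and it terminates when it enters that state. An algorithm solves $g$-partial gathering if all agents terminate, and in the final configuration at least $g$ agents are at every node where an agent is. **Theorem.** There is a constant $C>0$ such that for all integers $n,k,g\ge 0$ with $2g+1\le k\le 3g-2$ and $k\le n$ there is a deterministic algorithm that, for all identifiers, starting nodes, missing links and orders of actions, solves the $g$-partial gathering problem within $C\,n\log g$ rounds and with at most $C\,gn\log g$ moves in total. Moreover it consists of the following two phases, for some numbers of rounds $S,L\le Cn$ and $s$, with $S\ge 3n$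 and $L\ge s+n$, that depend only on the algorithm. 1. *Selection phase* ($S$ rounds). Every agent tries to move forward in each of the first $3n$ rounds and then stays. At the end of the phase, either all agents are at one node and have terminated, or every agent has made at least $n$ moves (gone once around the ring), and the starting node of the agent with the minimum identifier is selected as the gathering node: in each of the next $3n$ rounds, every agent tries to move forward unless it is at that node, where it stays. 2. *Gathering phase by splitting* (after these $3n$ rounds), in subphases of $L$ rounds. At the beginning of each subphase at most two nodes are occupied. Call $\max_v \max(0,\,g-\#\{\text{agents at }v\})$, over the occupied nodes $v$, the deficit. If it is $0$, then all agents terminate during the subphase without moving. Otherwise let $v$ be the occupied node with fewer than $g$ agents, and let $g+c$ be the number of agents at the other one. After $s$ rounds in which no agent moves, for $n$ rounds, the agents at $v$ stay; of the others, the $g$ agents with the smallest identifiers stay, the next $\lfloor c/2\rfloor$ in the order of identifiers try to move forward until they are at $v$, and the remaining ones try to move backward until they are at $v$. At the end of the subphase the deficit is at most half of what it was at its beginning. -/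

import Mathlib

/-- A deterministic algorithm for mobile agents on a ring whose nodes carry whiteboards. An agent is
an automaton whose initial state, final state and transition function may depend on its own
identifier (a natural number). A transition reads the state of the agent and the whiteboard of its
current node, and yields the new state, the new whiteboard and a movement: `1` (forward), `-1`
(backward) or `0` (stay). Nothing else is visible to the agent: not the name of its node, not the
other agents there, not whether its last attempt to move was blocked. -/
structure Algorithm where
  /-- the states of agents -/
  State : Type
  /-- the contents of whiteboards -/
  Board : Type
  /-- the initial state of the agent with a given identifier -/
  init : ℕ → State
  /-- the final state of the agent with a given identifier -/
  final : ℕ → State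
  /-- the initial whiteboard of a node where an agent starts -/
  boardOccupied : Board
  /-- the initial whiteboard of a node where no agent starts -/
  boardEmpty : Board
  /-- the transition function of the agent with a given identifier -/
  step : ℕ → State → Board → State × Board × SignType
  /-- in its final state an agent does nothing any more -/
  step_final : ∀ a w, step a (final a) w = (final a, w, 0)

/-- The agents are *finite* automata: as soon as the identifiers come from a finite set, finitely
many states and finitely many whiteboard contents suffice. (The algorithm itself is not told that
finite set.) -/
def Algorithm.IsFinite (A : Algorithm) : Prop :=
  ∀ I : Finset ℕ, ∃ (P : Set A.State) (Q : Set A.Board), P.Finite ∧ Q.Finite ∧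
    A.boardOccupied ∈ Q ∧ A.boardEmpty ∈ Q ∧
    (∀ a ∈ I, A.init a ∈ P ∧ A.final a ∈ P) ∧
    ∀ a ∈ I, ∀ p ∈ P, ∀ q ∈ Q, (A.step a p q).1 ∈ P ∧ (A.step a p q).2.1 ∈ Q

/-- Everything the algorithm does not control, for `k` agents on the ring with nodes
`ZMod n` and links `{v, v + 1}`: distinct identifiers, distinct starting nodes, and the choices of
the adversarial scheduler. -/
structure Scenario (n k : ℕ) where
  /-- the identifiers of the agents -/
  ids : Fin k → ℕ
  ids_injective : Function.Injective ids
  /-- the starting nodes of the agents -/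
  start : Fin k → ZMod n
  start_injective : Function.Injective start
  /-- the link that is missing in each round, if any; `some v` stands for the link `{v, v + 1}` -/
  missing : ℕ → Option (ZMod n)
  /-- the order in which the agents take their atomic actions in each round -/
  order : ℕ → Equiv.Perm (Fin k)

/-- Where an agent at node `v` is after an attempted movement, when the link `e` is missing. -/
def attempt {n : ℕ} (e : Option (ZMod n)) (v : ZMod n) : SignType → ZMod n
  | .zero => v
  | .pos => if e = some v then v else v + 1
  | .neg => if e = some (v - 1) then v else v - 1

/-- A configuration: the states and locations of all agents, and all whiteboards. -/
structure Config (A : Algorithm) (n k : ℕ) where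
  state : Fin k → A.State
  board : ZMod n → A.Board
  loc : Fin k → ZMod n

namespace Algorithm

variable (A : Algorithm) {n k : ℕ} (X : Scenario n k)

/-- The initial configuration. -/
def initial : Config A n k where
  state i := A.init (X.ids i)
  board v := open Classical in if ∃ i, X.start i = v then A.boardOccupied else A.boardEmpty
  loc := X.start

/-- The atomic action of agent `i` when the link `e` is missing. -/
def act (e : Option (ZMod n)) (c : Config A n k) (i : Fin k) : Config A n k :=
  let r := A.step (X.ids i) (c.state i) (c.board (c.loc i))
  { state := Function.update c.state i r.1
    board := Function.update c.board (c.loc i) r.2.1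
    loc := Function.update c.loc i (attempt e (c.loc i) r.2.2) }

/-- The configuration after `t` rounds; in each round every agent takes one atomic action. -/
def run : ℕ → Config A n k
  | 0 => A.initial X
  | t + 1 => ((List.finRange k).map (X.order t)).foldl (A.act X (X.missing t)) (run t)

/-- The locations of the agents after `t` rounds. -/
def loc (t : ℕ) : Fin k → ZMod n := (A.run X t).loc

/-- After `t` rounds all agents have terminated. -/
def Terminated (t : ℕ) : Prop := ∀ i, (A.run X t).state i = A.final (X.ids i)

/-- The number of links that agent `i` traverses in the first `T` rounds (for `n ≥ 2`). -/
def moves (T : ℕ) (i : Fin k) : ℕ :=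
  ((Finset.range T).filter fun t => A.loc X (t + 1) i ≠ A.loc X t i).card

end Algorithm

/-- The number of agents at node `v`. -/
def agentsAt {n k : ℕ} (p : Fin k → ZMod n) (v : ZMod n) : ℕ :=
  (Finset.univ.filter fun i => p i = v).card

/-- At least `g` agents are at every node where there is an agent. -/
def PartiallyGathered {n k : ℕ} (g : ℕ) (p : Fin k → ZMod n) : Prop :=
  ∀ v, (∃ i, p i = v) → g ≤ agentsAt p v

/-- The algorithm solves `g`-partial gathering in the given scenario within `R` rounds and with at
most `M` moves in total: all agents terminate, and the final configuration is gathered. -/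
def SolvesWithin (A : Algorithm) {n k : ℕ} (X : Scenario n k) (g : ℕ) (R M : ℝ) : Prop :=
  ∃ T : ℕ, (T : ℝ) ≤ R ∧ A.Terminated X T ∧ PartiallyGathered g (A.loc X T) ∧
    ((∑ i, A.moves X T i : ℕ) : ℝ) ≤ M

/-- The largest number of agents that an occupied node lacks for having `g` agents. -/
def deficit {n k : ℕ} (g : ℕ) (p : Fin k → ZMod n) : ℕ :=
  Finset.univ.sup fun i => g - agentsAt p (p i)

/-- The rank of agent `i` by identifier among the agents at its node (`1` is the smallest). -/
def rank {n k : ℕ} (ids : Fin k → ℕ) (p : Fin k → ZMod n) (i : Fin k) : ℕ :=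
  (Finset.univ.filter fun j => p j = p i ∧ ids j ≤ ids i).card

/-- Splitting `g + c` agents at a node: the `g` agents with the smallest identifiers stay, the next
`⌊c / 2⌋` go forward, the others backward. At a node with at most `g` agents all stay. -/
def splitDir {n k : ℕ} (g : ℕ) (ids : Fin k → ℕ) (p : Fin k → ZMod n) (i : Fin k) : SignType :=
  if rank ids p i ≤ g then 0
  else if rank ids p i ≤ g + (agentsAt p (p i) - g) / 2 then 1
  else -1

/-- The selection phase, lasting `S ≥ 3n` rounds: every agent tries to move forward in each of the
first `3n` rounds, and stays during the remaining ones. In the end all agents are at one node and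
have terminated, or every agent has gone once around the ring and all of them have selected
the starting node of the agent with the smallest identifier: for another `3n` rounds, every agent
tries to move forward until it is at that node. -/
structure SelectionPhase (A : Algorithm) {n k : ℕ} (X : Scenario n k) (S : ℕ) : Prop where
  length : 3 * n ≤ S
  forward : ∀ t < 3 * n, ∀ i, A.loc X (t + 1) i = attempt (X.missing t) (A.loc X t i) 1
  stay : ∀ t, 3 * n ≤ t → t < S → A.loc X (t + 1) = A.loc X t
  outcome :
    (A.Terminated X S ∧ ∀ i j, A.loc X S i = A.loc X S j) ∨
    ((∀ i, n ≤ A.moves X S i) ∧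
      ∀ m, (∀ j, X.ids m ≤ X.ids j) → ∀ t, S ≤ t → t < S + 3 * n → ∀ i,
        A.loc X (t + 1) i =
          if A.loc X t i = X.start m then A.loc X t i
          else attempt (X.missing t) (A.loc X t i) 1)

/-- The splitting that starts after `B` rounds, in subphases of `L` rounds. At the beginning of
each subphase at most two nodes are occupied. If no node lacks agents, then all agents terminate
where they are. Otherwise, after `s` rounds of staying, the agents are split and, for `n` rounds,
try to move in their directions until they are at the node that lacks agents; and
at the end of the subphase the deficit is at most half of what it was. -/
structure SplittingPhase (A : Algorithm) {n k : ℕ} (X : Scenario n k) (g B s L : ℕ) : Prop where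
  length : s + n ≤ L
  twoNodes : ∀ j, ∃ u v, ∀ i, A.loc X (B + j * L) i = u ∨ A.loc X (B + j * L) i = v
  finish : ∀ j, deficit g (A.loc X (B + j * L)) = 0 →
    A.Terminated X (B + (j + 1) * L) ∧ ∀ t ≥ B + j * L, A.loc X t = A.loc X (B + j * L)
  stay : ∀ j, ∀ t, B + j * L ≤ t → t < B + j * L + s → A.loc X (t + 1) = A.loc X t
  split : ∀ j v, 0 < agentsAt (A.loc X (B + j * L)) v → agentsAt (A.loc X (B + j * L)) v < g →
    ∀ t, B + j * L + s ≤ t → t < B + j * L + s + n → ∀ i,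
      A.loc X (t + 1) i =
        if A.loc X t i = v then v
        else attempt (X.missing t) (A.loc X t i) (splitDir g X.ids (A.loc X (B + j * L)) i)
  halve : ∀ j,
    2 * deficit g (A.loc X (B + (j + 1) * L)) ≤ deficit g (A.loc X (B + j * L))

/-!
The whiteboards make the agents effectively synchronous and observant. Every agent records its
identifier and its current role in every round, and agents read only the records of earlier rounds.
Therefore the order of the actions within a round is irrelevant (`foldl_act`, `round`), and an agent
can find out exactly which agents were at its node in a given earlier round, and in which roles
(`crew_past`). In particular, it recognizes a node by who was there in that round.

*Selection.* Two agents at different nodes are not blocked in the same round when they move in the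
same direction. Hence, if an agent marches forward for `3n` rounds and does not end at the node of
some other agent, then it has gone once around the ring (`march_apart`) and knows the smallest
identifier. When all agents then go to the starting node of the agent with that identifier, those
that do not arrive end at one node (`forward_together`).

*Splitting.* Let `u` have `g + c` agents and `v` only `g - d`, with `d > 0`. Two groups that walk
from `u` to `v` on the two arcs are never blocked in the same round, so one of them arrives. As
`c ≥ d + 1`, each group has at least `d / 2` agents, and this arrival halves the deficit. But the
other group, sent in direction `r`, may be stranded between `u` and `v`, and has to be brought to an
occupied node, although the anchors (the `g` agents left at `u`) do not know which group that is.
It turns back to `u`, while all agents at `v`, who know who has arrived, walk in direction `r` to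
`u`. Again the arcs are disjoint, so one of the two arrives (`returning_arrives`). If the stranded
group does, only two nodes are occupied. Otherwise everyone at `u` now knows what has happened;
the anchors walk to the stranded group in direction `r`, the others in direction `-r`, and one of
these arrives. In every case the stranded group joins either the anchors or the agents from `v`, and
the latter, with the group that had arrived, number at least `g - d / 2`
(`Formation.halve`, `subphase_split`).

A subphase has three stages, for these three walks; each consists of one round of recording, one
round of deciding and `n` rounds of walking. After at most `log₂ g + 1` subphases the deficit is
zero, and one more suffices for noticing that and terminating.
-/

/-! ### The algorithm -/

namespace PartialGathering

/-- The part an agent plays in a subphase of the splitting: `none` if it is at the node that lacks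
agents, and `some d` if it is at the other node, which it is to leave in direction `d` (`d = 0` for
the anchors, which stay). -/
abbrev Role := Option SignType

/-- A whiteboard records who acted at the node, and when: `(τ, a, r)` means that the agent with
identifier `a` acted here in round `τ`, having role `r`. -/
abbrev Log := Finset (ℕ × ℕ × Role)

/-- The identifiers and roles of the agents that acted in round `τ`. -/
def crew (w : Log) (τ : ℕ) : Finset (ℕ × Role) := (w.filter (·.1 = τ)).image (·.2)

/-- The memory of an agent that has not terminated. -/
structure Memory where
  /-- the number of the current round -/
  clock : ℕ
  /-- the smallest identifier known to the agent -/
  leader : ℕ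
  /-- the role in the current subphase -/
  role : Role
  /-- the direction in which to move in the current stage -/
  dir : SignType

/-- The number of rounds before the splitting. -/
def prelude (n : ℕ) : ℕ := 6 * n + 2

/-- The number of rounds after which all agents have terminated. -/
def horizon (n g : ℕ) : ℕ := prelude n + (Nat.log 2 g + 2) * (3 * (n + 2))

/-- The direction that no agent of the crew has as its role while one has the opposite direction;
`0` if there is no such direction. -/
def missingDir (c : Finset (ℕ × Role)) : SignType :=
  if some 1 ∈ c.image Prod.snd then
    if some (-1) ∈ c.image Prod.snd then 0 else -1
  else if some (-1) ∈ c.image Prod.snd then 1 else 0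

/-- The direction in which agent `a` leaves a node with agents `c`. -/
def departure (g a : ℕ) (c : Finset (ℕ × Role)) : SignType :=
  if (c.filter (·.1 ≤ a)).card ≤ g then 0
  else if (c.filter (·.1 ≤ a)).card ≤ g + (c.card - g) / 2 then 1
  else -1

/-- The decision of agent `a` in the second round of stage `p` of a subphase, where `c₀` and `c` are
the crews of its node in the first rounds of the subphase and of the stage; `none` means that it
terminates, which it does when no node lacks agents: the agents elsewhere are all at one node. -/
def decision (k g a p : ℕ) (m : Memory) (c₀ c : Finset (ℕ × Role)) : Option Memory :=
  if p = 0 then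
    if g ≤ c₀.card ∧ (c₀.card = k ∨ g ≤ k - c₀.card) then none
    else some { m with
      role := if c₀.card < g then none else some (departure g a c₀)
      dir := departure g a c₀ }
  else if p = 1 then
    some { m with dir := if 0 < c₀.card ∧ c₀.card < g then missingDir c else -m.dir }
  else
    some { m with dir :=
      if g ≤ c₀.card ∧ none ∈ c.image Prod.snd then
        if m.role = some 0 then missingDir c else -missingDir c
      else 0 }

/-- The nodes at which the agents moving in stage `p` of a subphase stop: the node that lacked
agents, the other node, and the node of the stranded group. -/
def Halt (g p : ℕ) (c₀ c : Finset (ℕ × Role)) : Prop :=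
  if p = 0 then 0 < c₀.card ∧ c₀.card < g
  else if p = 1 then g ≤ c₀.card
  else c.Nonempty ∧ none ∉ c.image Prod.snd

instance (g p : ℕ) (c₀ c : Finset (ℕ × Role)) : Decidable (Halt g p c₀ c) := by
  unfold Halt; infer_instance

/-- The stage of its subphase to which round `t` belongs. -/
def stage (n t : ℕ) : ℕ := (t - prelude n) / (n + 2) % 3

/-- The number of rounds of its stage before round `t`. -/
def offset (n t : ℕ) : ℕ := (t - prelude n) % (n + 2)

/-- The crew in the first round of the current stage. -/
def stageCrew (n t : ℕ) (w : Log) : Finset (ℕ × Role) := crew w (t - offset n t)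

/-- The crew in the first round of the current subphase. -/
def subphaseCrew (n t : ℕ) (w : Log) : Finset (ℕ × Role) :=
  crew w (t - offset n t - stage n t * (n + 2))

/-- The memory of agent `a` after an action (apart from the clock), `none` if it terminates. -/
def update (n k g a : ℕ) (m : Memory) (w : Log) : Option Memory :=
  if m.clock < 3 * n then
    some { m with leader :=
      (insert m.leader ((crew w 0).image Prod.fst)).min' (Finset.insert_nonempty _ _) }
  else if m.clock < prelude n then
    if m.clock = 3 * n + 1 ∧ (crew w (3 * n)).card = k then none else some m
  else if offset n m.clock = 1 then
    decision k g a (stage n m.clock) m (subphaseCrew n m.clock w) (stageCrew n m.clock w)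
  else some m

/-- The movement of an agent with memory `m`. -/
def heading (n g : ℕ) (m : Memory) (w : Log) : SignType :=
  if m.clock < 3 * n then 1
  else if m.clock < 3 * n + 2 then 0
  else if m.clock < prelude n then
    if m.leader ∈ (crew w 0).image Prod.fst then 0 else 1
  else if offset n m.clock < 2 then 0
  else if Halt g (stage n m.clock) (subphaseCrew n m.clock w) (stageCrew n m.clock w) then 0
  else m.dir

/-- The records of earlier rounds. Agents ignore those of the current round, so that the order in
which they act does not matter. -/
def past (m : Memory) (w : Log) : Log := w.filter (·.1 < m.clock)

/-- The state of agent `a` after an action. -/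
def next (n k g a : ℕ) : Option Memory → Log → Option Memory
  | none, _ => none
  | some m, w =>
    if m.clock < horizon n g then
      (update n k g a m (past m w)).map fun m' => { m' with clock := m.clock + 1 }
    else none

/-- What agent `a` records on the whiteboard. -/
def note (n g a : ℕ) : Option Memory → Log
  | none => ∅
  | some m => if m.clock < horizon n g then {(m.clock, a, m.role)} else ∅

/-- The movement of an agent. -/
def move (n g : ℕ) : Option Memory → Log → SignType
  | none, _ => 0
  | some m, w => if m.clock < horizon n g then heading n g m (past m w) else 0

/-- The algorithm: selection of a gathering node, and gathering by splitting. -/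
abbrev splitting (n k g : ℕ) : Algorithm where
  State := Option Memory
  Board := Log
  init a := some ⟨0, a, none, 0⟩
  final _ := none
  boardOccupied := ∅
  boardEmpty := ∅
  step a s w := (next n k g a s w, w ∪ note n g a s, move n g s w)
  step_final a w := by simp [next, note, move]

theorem update_leader_mem {n k g a : ℕ} {m m' : Memory} {w : Log}
    (h : update n k g a m w = some m') :
    m'.leader ∈ insert m.leader ((crew w 0).image Prod.fst) := by
  unfold update at h
  split_ifs at h
  · rw [Option.some.injEq] at h
    subst h
    exact Finset.min'_mem _ (Finset.insert_nonempty _ _)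
  · obtain rfl := Option.some.inj h
    exact Finset.mem_insert_self _ _
  · unfold decision at h
    split_ifs at h <;> obtain rfl := Option.some.inj h <;> exact Finset.mem_insert_self _ _
  · obtain rfl := Option.some.inj h
    exact Finset.mem_insert_self _ _

theorem splitting_isFinite (n k g : ℕ) : (splitting n k g).IsFinite := by
  intro I
  let P : Set (Option Memory) :=
    insert none (some '' ((fun x : ℕ × ℕ × Role × SignType => ⟨x.1, x.2.1, x.2.2.1, x.2.2.2⟩) ''
      (Set.Iic (horizon n g) ×ˢ (I : Set ℕ) ×ˢ Set.univ)))
  let F : Log := Finset.range (horizon n g) ×ˢ I ×ˢ Finset.univ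
  have hP : ∀ m : Memory, some m ∈ P ↔ m.clock ≤ horizon n g ∧ m.leader ∈ I := by
    intro m
    constructor
    · rintro (h | ⟨_, ⟨⟨x, y, z, u⟩, hx, rfl⟩, h⟩)
      · cases h
      · obtain rfl := Option.some.inj h
        exact ⟨hx.1, hx.2.1⟩
    · rintro ⟨h₁, h₂⟩
      exact Or.inr ⟨m, ⟨(m.clock, m.leader, m.role, m.dir), ⟨h₁, h₂, trivial⟩, rfl⟩, rfl⟩
  refine ⟨P, (F.powerset : Set Log), ?_, F.powerset.finite_toSet, ?_, ?_, ?_, ?_⟩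
  · refine Set.Finite.insert _ (Set.Finite.image _ (Set.Finite.image _ ?_))
    exact (Set.finite_Iic _).prod (I.finite_toSet.prod Set.finite_univ)
  · exact Finset.mem_coe.2 (Finset.empty_mem_powerset _)
  · exact Finset.mem_coe.2 (Finset.empty_mem_powerset _)
  · exact fun a ha => ⟨(hP _).2 ⟨Nat.zero_le _, ha⟩, Or.inl rfl⟩
  · intro a ha p hp q hq
    have hq' : q ⊆ F := Finset.mem_powerset.1 (Finset.mem_coe.1 hq)
    change next n k g a p q ∈ P ∧ q ∪ note n g a p ∈ (F.powerset : Set Log)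
    rw [Finset.mem_coe, Finset.mem_powerset]
    cases p with
    | none => exact ⟨Or.inl rfl, by simpa [note] using hq'⟩
    | some m =>
      obtain ⟨h₁, h₂⟩ := (hP m).1 hp
      by_cases hc : m.clock < horizon n g
      · constructor
        · simp only [next, if_pos hc]
          cases hu : update n k g a m (past m q) with
          | none => exact Or.inl rfl
          | some m' =>
            refine (hP _).2 ⟨hc, ?_⟩
            have := update_leader_mem hu
            rw [Finset.mem_insert] at this
            rcases this with h | h
            · exact h ▸ h₂
            · simp only [crew, past, Finset.mem_image, Finset.mem_filter] at h
              obtain ⟨_, ⟨e, ⟨⟨he, _⟩, _⟩, rfl⟩, h⟩ := h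
              have := hq' he
              simp only [F, Finset.mem_product] at this
              exact h ▸ this.2.1
        · simp only [note, if_pos hc]
          refine Finset.union_subset hq' (Finset.singleton_subset_iff.2 ?_)
          simp [F, hc, ha]
      · exact ⟨by simp only [next, if_neg hc]; exact Or.inl rfl, by simpa [note, hc] using hq'⟩

/-! ### Rounds of the algorithm do not depend on the order of actions -/

section Rounds

variable {n k g : ℕ} (X : Scenario n k)

/-- The state of agent `i` after `t` rounds. -/
def stateAt (g t : ℕ) (i : Fin k) : Option Memory := ((splitting n k g).run X t).state i

/-- The whiteboard of node `v` after `t` rounds. -/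
def boardAt (g t : ℕ) (v : ZMod n) : Log := ((splitting n k g).run X t).board v

/-- The location of agent `i` after `t` rounds. -/
def locAt (g t : ℕ) (i : Fin k) : ZMod n := (splitting n k g).loc X t i

/-- The configuration is one at the beginning of round `t`: the clocks of the agents show `t`, and
all records are older. -/
def Timely (t : ℕ) (c : Config (splitting n k g) n k) : Prop :=
  (∀ i, ∀ m : Memory, c.state i = some m → m.clock = t) ∧
    ∀ v, ∀ e : ℕ × ℕ × Role, e ∈ (c.board v : Log) → e.1 < t

theorem note_clock {a t : ℕ} {s : Option Memory} (hs : ∀ m, s = some m → m.clock = t)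
    {e : ℕ × ℕ × Role} (he : e ∈ note n g a s) : e.1 = t := by
  cases s with
  | none => simp [note] at he
  | some m =>
    simp only [note] at he
    split_ifs at he
    · rw [Finset.mem_singleton] at he
      subst he
      exact hs m rfl
    · simp at he

theorem past_eq {t : ℕ} {m : Memory} (hm : m.clock = t) {w w' : Log}
    (h : ∀ e : ℕ × ℕ × Role, e.1 < t → (e ∈ w ↔ e ∈ w')) : past m w = past m w' := by
  ext e
  simp only [past, Finset.mem_filter]
  constructor <;> rintro ⟨h₁, h₂⟩ <;> exact ⟨by simpa [h e (hm ▸ h₂)] using h₁, h₂⟩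

theorem next_congr {a t : ℕ} {s : Option Memory} (hs : ∀ m, s = some m → m.clock = t)
    {w w' : Log} (h : ∀ e : ℕ × ℕ × Role, e.1 < t → (e ∈ w ↔ e ∈ w')) :
    next n k g a s w = next n k g a s w' ∧ move n g s w = move n g s w' := by
  cases s with
  | none => exact ⟨rfl, rfl⟩
  | some m => simp only [next, move, past_eq (hs m rfl) h, and_self]

open Classical in
/-- After the actions of the agents in `l`, each of them has acted as if it had been the first. -/
theorem foldl_act {t : ℕ} {c : Config (splitting n k g) n k} (hc : Timely t c)
    (e : Option (ZMod n)) (l : List (Fin k)) (hl : l.Nodup) :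
    let c' := l.foldl ((splitting n k g).act X e) c
    (∀ i, c'.state i =
      if i ∈ l then next n k g (X.ids i) (c.state i) (c.board (c.loc i)) else c.state i) ∧
    (∀ i, c'.loc i = if i ∈ l then
      attempt e (c.loc i) (move n g (c.state i) (c.board (c.loc i))) else c.loc i) ∧
    ∀ v, ∀ x : ℕ × ℕ × Role, x ∈ (c'.board v : Log) ↔
      x ∈ (c.board v : Log) ∨ ∃ i ∈ l, c.loc i = v ∧ x ∈ note n g (X.ids i) (c.state i) := by
  induction l using List.reverseRecOn with
  | nil => simp
  | append_singleton l j ih =>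
    obtain ⟨hl₁, hj⟩ : l.Nodup ∧ j ∉ l := by
      rw [List.nodup_append] at hl
      exact ⟨hl.1, fun h => hl.2.2 j h j (by simp) rfl⟩
    obtain ⟨ih₁, ih₂, ih₃⟩ := ih hl₁
    simp only [List.foldl_append, List.foldl_cons, List.foldl_nil]
    set c' := l.foldl ((splitting n k g).act X e) c with hc'
    have hst : c'.state j = c.state j := by rw [ih₁, if_neg hj]
    have hlo : c'.loc j = c.loc j := by rw [ih₂, if_neg hj]
    have hbo := next_congr (n := n) (k := k) (g := g) (a := X.ids j) (hc.1 j)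
      (w := c'.board (c.loc j)) (w' := c.board (c.loc j)) (fun x hx => by
        rw [ih₃]
        refine or_iff_left ?_
        rintro ⟨i, -, -, hi⟩
        exact hx.ne (note_clock (hc.1 i) hi))
    refine ⟨fun i => ?_, fun i => ?_, fun v x => ?_⟩
    · by_cases hij : i = j
      · subst hij
        simp only [Algorithm.act, splitting, Function.update_self, List.mem_append,
          List.mem_singleton, or_true, if_true]
        rw [hst, hlo]
        exact hbo.1
      · simp only [Algorithm.act, Function.update_of_ne hij, List.mem_append,
          List.mem_singleton, hij, or_false]
        exact ih₁ i
    · by_cases hij : i = j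
      · subst hij
        simp only [Algorithm.act, splitting, Function.update_self, List.mem_append,
          List.mem_singleton, or_true, if_true]
        rw [hst, hlo]
        exact congrArg _ hbo.2
      · simp only [Algorithm.act, Function.update_of_ne hij, List.mem_append,
          List.mem_singleton, hij, or_false]
        exact ih₂ i
    · have key : x ∈ ((((splitting n k g).act X e c' j).board v : Log)) ↔
          x ∈ (c'.board v : Log) ∨ (c.loc j = v ∧ x ∈ note n g (X.ids j) (c.state j)) := by
        by_cases hv : c.loc j = v
        · subst hv
          simp only [Algorithm.act, splitting, hlo, Function.update_self, true_and]
          rw [hst]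
          exact Finset.mem_union
        · simp only [Algorithm.act, hlo, hv, false_and, or_false]
          rw [Function.update_of_ne (Ne.symm hv)]
      rw [key, ih₃]
      simp only [List.mem_append, List.mem_singleton, or_and_right, exists_or, exists_eq_left,
        or_assoc]

theorem next_clock {a t : ℕ} {s : Option Memory} (hs : ∀ m, s = some m → m.clock = t) {w : Log}
    {m : Memory} (h : next n k g a s w = some m) : m.clock = t + 1 := by
  cases s with
  | none => simp [next] at h
  | some m' =>
    simp only [next] at h
    split_ifs at h
    rw [Option.map_eq_some_iff] at h
    obtain ⟨m'', -, rfl⟩ := h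
    simp [hs m' rfl]

theorem timely_run (t : ℕ) : Timely t ((splitting n k g).run X t) := by
  induction t with
  | zero =>
    refine ⟨fun i m h => ?_, fun v e he => ?_⟩
    · obtain rfl := Option.some.inj h
      rfl
    · simp [Algorithm.run, Algorithm.initial, splitting] at he
  | succ t ih =>
    have hl : ((List.finRange k).map (X.order t)).Nodup :=
      (List.nodup_finRange k).map (X.order t).injective
    have h := foldl_act X ih (X.missing t) _ hl
    refine ⟨fun i m hm => ?_, fun v e he => ?_⟩
    · have := h.1 i
      rw [if_pos (by simpa using ⟨(X.order t).symm i, by simp⟩)] at this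
      exact next_clock (ih.1 i) (this.symm.trans hm)
    · rcases (h.2.2 v e).1 he with h | ⟨i, -, -, hi⟩
      · exact (ih.2 v e h).trans (Nat.lt_succ_self t)
      · exact (note_clock (ih.1 i) hi).trans_lt (Nat.lt_succ_self t)

theorem stateAt_zero (i : Fin k) : stateAt X g 0 i = some ⟨0, X.ids i, none, 0⟩ := rfl

/-- The effect of a round, in which all agents act on the configuration at its beginning. -/
theorem round (t : ℕ) :
    (∀ i, stateAt X g (t + 1) i =
      next n k g (X.ids i) (stateAt X g t i) (boardAt X g t (locAt X g t i))) ∧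
    (∀ i, locAt X g (t + 1) i = attempt (X.missing t) (locAt X g t i)
      (move n g (stateAt X g t i) (boardAt X g t (locAt X g t i)))) ∧
    ∀ v x, x ∈ boardAt X g (t + 1) v ↔ x ∈ boardAt X g t v ∨
      ∃ i, locAt X g t i = v ∧ x ∈ note n g (X.ids i) (stateAt X g t i) := by
  have hl : ((List.finRange k).map (X.order t)).Nodup :=
    (List.nodup_finRange k).map (X.order t).injective
  have hm : ∀ i, i ∈ (List.finRange k).map (X.order t) := fun i => by
    simpa using ⟨(X.order t).symm i, by simp⟩
  have h := foldl_act X (timely_run (g := g) X t) (X.missing t) _ hl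
  simp only [hm, if_true, true_and] at h
  exact h

/-- Whiteboards contain the records of all earlier actions at their nodes, and nothing else. -/
theorem mem_boardAt (t : ℕ) (v : ZMod n) (x : ℕ × ℕ × Role) : x ∈ boardAt X g t v ↔
    ∃ τ < t, ∃ i, locAt X g τ i = v ∧ x ∈ note n g (X.ids i) (stateAt X g τ i) := by
  induction t with
  | zero => simp [boardAt, Algorithm.run, Algorithm.initial, splitting]
  | succ t ih =>
    rw [(round X t).2.2, ih]
    constructor
    · rintro (⟨τ, hτ, h⟩ | h)
      · exact ⟨τ, hτ.trans (Nat.lt_succ_self t), h⟩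
      · exact ⟨t, Nat.lt_succ_self t, h⟩
    · rintro ⟨τ, hτ, h⟩
      rcases Nat.lt_succ_iff_lt_or_eq.1 hτ with h' | rfl
      · exact Or.inl ⟨τ, h', h⟩
      · exact Or.inr h

theorem stateAt_clock {t : ℕ} {i : Fin k} {m : Memory} (h : stateAt X g t i = some m) :
    m.clock = t := (timely_run X t).1 i m h

/-- What agents read about a round `τ` in which all agents were active. -/
theorem crew_past {τ t : ℕ} (hτ : τ < t) (hT : τ < horizon n g) {m : Fin k → Memory}
    (hm : ∀ i, stateAt X g τ i = some (m i)) (v : ZMod n) {m' : Memory} (hm' : m'.clock = t) :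
    crew (past m' (boardAt X g t v)) τ =
      (Finset.univ.filter fun i => locAt X g τ i = v).image fun i => (X.ids i, (m i).role) := by
  ext x
  simp only [crew, past, Finset.mem_image, Finset.mem_filter, Finset.mem_univ, true_and,
    mem_boardAt]
  constructor
  · rintro ⟨e, ⟨⟨⟨τ', -, i, hi, he⟩, -⟩, heτ⟩, rfl⟩
    have : τ' = τ := by rw [← heτ, note_clock (fun m h => stateAt_clock X h) he]
    subst this
    rw [hm i, note, if_pos (by rwa [stateAt_clock X (hm i)]), Finset.mem_singleton] at he
    exact ⟨i, hi, by rw [he]⟩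
  · rintro ⟨i, hi, rfl⟩
    have hc := stateAt_clock X (hm i)
    refine ⟨(τ, X.ids i, (m i).role), ⟨⟨⟨τ, hτ, i, hi, ?_⟩, by rwa [hm']⟩, rfl⟩, rfl⟩
    rw [hm i, note, if_pos (by rwa [hc]), hc]
    exact Finset.mem_singleton_self _

/-- Agents that have terminated stay for ever. -/
theorem terminated_forever {t : ℕ} (h : ∀ i, stateAt X g t i = none) {t' : ℕ} (ht : t ≤ t') :
    (∀ i, stateAt X g t' i = none) ∧ locAt X g t' = locAt X g t := by
  induction t', ht using Nat.le_induction with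
  | base => exact ⟨h, rfl⟩
  | succ t' _ ih =>
    refine ⟨fun i => ?_, ?_⟩
    · rw [(round X t').1, ih.1]; rfl
    · rw [← ih.2]
      funext i
      rw [(round X t').2.1, ih.1]; rfl

/-- A round of an agent that is still active. -/
theorem active_round {t : ℕ} (hT : t < horizon n g) {i : Fin k} {m : Memory}
    (hm : stateAt X g t i = some m) :
    stateAt X g (t + 1) i =
      (update n k g (X.ids i) m (past m (boardAt X g t (locAt X g t i)))).map
        (fun m' => { m' with clock := t + 1 }) ∧
    locAt X g (t + 1) i = attempt (X.missing t) (locAt X g t i)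
      (heading n g m (past m (boardAt X g t (locAt X g t i)))) := by
  have hc := stateAt_clock X hm
  constructor
  · rw [(round X t).1, hm, next, if_pos (by rwa [hc]), hc]
  · rw [(round X t).2.1, hm, move, if_pos (by rwa [hc])]

end Rounds

end PartialGathering

/-! ### Walks on a ring with a missing link -/

namespace PartialGathering

section Ring

variable {n : ℕ}

theorem attempt_zero (e : Option (ZMod n)) (v : ZMod n) : attempt e v 0 = v := rfl

theorem attempt_one (e : Option (ZMod n)) (v : ZMod n) :
    attempt e v 1 = if e = some v then v else v + 1 := rfl

theorem attempt_neg_one (e : Option (ZMod n)) (v : ZMod n) :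
    attempt e v (-1) = if e = some (v - 1) then v else v - 1 := rfl

theorem val_sub_one [NeZero n] (hn : 2 ≤ n) {x : ZMod n} (hx : x ≠ 0) :
    (x - 1).val + 1 = x.val := by
  have h1 : (1 : ZMod n).val = 1 := ZMod.val_one'' (by omega)
  have : 0 < x.val := ZMod.val_pos.2 hx
  rw [ZMod.val_sub (by omega), h1]
  omega

theorem val_sub_add_val_sub [NeZero n] {x y : ZMod n} (h : x ≠ y) :
    (x - y).val + (y - x).val = n := by
  have h' : x - y ≠ 0 := sub_ne_zero.2 h
  have := ZMod.neg_val (x - y)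
  rw [if_neg h', neg_sub] at this
  have := ZMod.val_lt (x - y)
  omega

/-- The locations of an agent that tries to move in direction `d` until it is at `w`; the link `e t`
is missing in round `t`. -/
def walk (e : ℕ → Option (ZMod n)) (w : ZMod n) (d : SignType) (p : ZMod n) : ℕ → ZMod n
  | 0 => p
  | t + 1 => if walk e w d p t = w then walk e w d p t else attempt (e t) (walk e w d p t) d

variable {e : ℕ → Option (ZMod n)} {w p q : ZMod n}

theorem walk_succ (d : SignType) (t : ℕ) : walk e w d p (t + 1) =
    if walk e w d p t = w then walk e w d p t else attempt (e t) (walk e w d p t) d := rfl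

theorem walk_self (d : SignType) (t : ℕ) : walk e w d w t = w := by
  induction t with
  | zero => rfl
  | succ t ih => rw [walk_succ, if_pos ih, ih]

theorem walk_zero_dir (t : ℕ) : walk e w 0 p t = p := by
  induction t with
  | zero => rfl
  | succ t ih => rw [walk_succ, attempt_zero, ite_self, ih]

theorem walk_eq_of_le {d : SignType} {t t' : ℕ} (h : walk e w d p t = w) (ht : t ≤ t') :
    walk e w d p t' = w := by
  induction t', ht using Nat.le_induction with
  | base => exact h
  | succ t' _ ih => rw [walk_succ, if_pos ih, ih]

theorem forward_step [NeZero n] (hn : 2 ≤ n) {t : ℕ} (h : walk e w 1 p t ≠ w) :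
    (w - walk e w 1 p (t + 1)).val + (if e t = some (walk e w 1 p t) then 0 else 1) =
      (w - walk e w 1 p t).val := by
  rw [walk_succ, if_neg h, attempt_one]
  split_ifs
  · rfl
  · rw [← sub_sub]
    exact val_sub_one hn (sub_ne_zero.2 h.symm)

theorem backward_step [NeZero n] (hn : 2 ≤ n) {t : ℕ} (h : walk e w (-1) p t ≠ w) :
    (walk e w (-1) p (t + 1) - w).val + (if e t = some (walk e w (-1) p t - 1) then 0 else 1) =
      (walk e w (-1) p t - w).val := by
  rw [walk_succ, if_neg h, attempt_neg_one]
  split_ifs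
  · rfl
  · rw [sub_right_comm]
    exact val_sub_one hn (sub_ne_zero.2 h)

theorem forward_le [NeZero n] (hn : 2 ≤ n) (t : ℕ) :
    (w - walk e w 1 p t).val ≤ (w - p).val := by
  induction t with
  | zero => rfl
  | succ t ih =>
    by_cases h : walk e w 1 p t = w
    · rwa [walk_succ, if_pos h]
    · have := forward_step hn h
      omega

theorem backward_le [NeZero n] (hn : 2 ≤ n) (t : ℕ) :
    (walk e w (-1) p t - w).val ≤ (p - w).val := by
  induction t with
  | zero => rfl
  | succ t ih =>
    by_cases h : walk e w (-1) p t = w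
    · rwa [walk_succ, if_pos h]
    · have := backward_step hn h
      omega

/-- Two agents approaching `w` from both sides on disjoint arcs are never blocked in the same round,
so that one of them arrives within `n` rounds. -/
theorem forward_or_backward_arrives [NeZero n] (hn : 2 ≤ n)
    (h : (w - p).val + (q - w).val ≤ n) :
    walk e w 1 p n = w ∨ walk e w (-1) q n = w := by
  have key : ∀ t, walk e w 1 p t = w ∨ walk e w (-1) q t = w ∨
      (w - walk e w 1 p t).val + (walk e w (-1) q t - w).val + t ≤ n := by
    intro t
    induction t with
    | zero => exact Or.inr (Or.inr h)
    | succ t ih =>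
      by_cases h₁ : walk e w 1 p t = w
      · exact Or.inl (walk_eq_of_le h₁ t.le_succ)
      by_cases h₂ : walk e w (-1) q t = w
      · exact Or.inr (Or.inl (walk_eq_of_le h₂ t.le_succ))
      have h₃ := (ih.resolve_left h₁).resolve_left h₂
      have s₁ := forward_step hn h₁
      have s₂ := backward_step hn h₂
      refine Or.inr (Or.inr ?_)
      by_cases b₁ : e t = some (walk e w 1 p t)
      · by_cases b₂ : e t = some (walk e w (-1) q t - 1)
        · -- Blocked by the same link, they face each other, on arcs that overlap in it.
          exfalso
          rw [b₁, Option.some.injEq] at b₂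
          have s₃ := val_sub_one hn (sub_ne_zero.2 h₂)
          rw [sub_right_comm, ← b₂] at s₃
          have := val_sub_add_val_sub h₁
          omega
        · rw [if_neg b₂] at s₂
          omega
      · rw [if_neg b₁] at s₁
        omega
  have := key n
  by_contra! hc
  have h₃ := (this.resolve_left hc.1).resolve_left hc.2
  have : 0 < (w - walk e w 1 p n).val := ZMod.val_pos.2 (sub_ne_zero.2 hc.1.symm)
  omega

/-- Two groups leaving a node in opposite directions for the same destination: one arrives. -/
theorem splitting_arrives [NeZero n] (hn : 2 ≤ n) (e : ℕ → Option (ZMod n)) (u v : ZMod n) :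
    walk e v 1 u n = v ∨ walk e v (-1) u n = v := by
  refine forward_or_backward_arrives hn ?_
  by_cases h : u = v
  · simp [h]
  · exact (val_sub_add_val_sub (Ne.symm h)).le

/-- A group stranded on its way from `u` to `v` goes back to `u`, while the agents at `v` go to `u`
by the other arc: one arrives. -/
theorem returning_arrives [NeZero n] (hn : 2 ≤ n) (e e' : ℕ → Option (ZMod n)) {u v : ZMod n}
    (huv : u ≠ v) {r : SignType} (hr : r = 1 ∨ r = -1) (s : ℕ) :
    walk e' u r v n = u ∨ walk e' u (-r) (walk e v r u s) n = u := by
  rcases hr with rfl | rfl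
  · refine forward_or_backward_arrives hn ?_
    have h₁ := forward_le (e := e) (w := v) (p := u) hn s
    have h₂ := ZMod.val_sub h₁
    rw [sub_sub_sub_cancel_left] at h₂
    have := val_sub_add_val_sub huv
    omega
  · rw [neg_neg, or_comm]
    refine forward_or_backward_arrives hn ?_
    have h₁ := backward_le (e := e) (w := v) (p := u) hn s
    have h₂ := ZMod.val_sub h₁
    rw [sub_sub_sub_cancel_right] at h₂
    have := val_sub_add_val_sub huv
    omega

/-- Agents that move in the same direction to the same node and are not yet there are blocked in the
same round only if they are together. Hence after `2n` rounds they are together, or one of them has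
arrived. -/
theorem forward_together [NeZero n] (hn : 2 ≤ n) {T : ℕ} (hT : 2 * n ≤ T) :
    walk e w 1 p T = w ∨ walk e w 1 q T = w ∨ walk e w 1 p T = walk e w 1 q T := by
  have key : ∀ t, walk e w 1 p t = w ∨ walk e w 1 q t = w ∨ walk e w 1 p t = walk e w 1 q t ∨
      (w - walk e w 1 p t).val + (w - walk e w 1 q t).val + t ≤ 2 * n := by
    intro t
    induction t with
    | zero =>
      have h₁ := ZMod.val_lt (w - p)
      have h₂ := ZMod.val_lt (w - q)
      refine Or.inr (Or.inr (Or.inr ?_))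
      change (w - p).val + (w - q).val + 0 ≤ 2 * n
      omega
    | succ t ih =>
      by_cases h₁ : walk e w 1 p t = w
      · exact Or.inl (walk_eq_of_le h₁ t.le_succ)
      by_cases h₂ : walk e w 1 q t = w
      · exact Or.inr (Or.inl (walk_eq_of_le h₂ t.le_succ))
      by_cases h₃ : walk e w 1 p t = walk e w 1 q t
      · refine Or.inr (Or.inr (Or.inl ?_))
        rw [walk_succ, walk_succ, h₃]
      have h₄ := ((ih.resolve_left h₁).resolve_left h₂).resolve_left h₃
      have s₁ := forward_step hn h₁
      have s₂ := forward_step hn h₂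
      refine Or.inr (Or.inr (Or.inr ?_))
      by_cases b₁ : e t = some (walk e w 1 p t)
      · have b₂ : e t ≠ some (walk e w 1 q t) := fun h => h₃ (Option.some.inj (b₁.symm.trans h))
        rw [if_neg b₂] at s₂
        omega
      · rw [if_neg b₁] at s₁
        omega
  by_contra! hc
  have h := (((key T).resolve_left hc.1).resolve_left hc.2.1).resolve_left hc.2.2
  have : 0 < (w - walk e w 1 p T).val := ZMod.val_pos.2 (sub_ne_zero.2 hc.1.symm)
  omega

/-- The number of moves in the first `T` rounds. -/
def moveCount (f : ℕ → ZMod n) (T : ℕ) : ℕ :=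
  ((Finset.range T).filter fun t => f (t + 1) ≠ f t).card

theorem moveCount_succ (f : ℕ → ZMod n) (T : ℕ) :
    moveCount f (T + 1) = moveCount f T + if f (T + 1) = f T then 0 else 1 := by
  unfold moveCount
  rw [Finset.range_add_one, Finset.filter_insert]
  by_cases h : f (T + 1) = f T
  · simp [h]
  · rw [if_pos h, if_neg h, Finset.card_insert_of_notMem (by simp)]

theorem moveCount_mono (f : ℕ → ZMod n) {T T' : ℕ} (h : T ≤ T') :
    moveCount f T ≤ moveCount f T' :=
  Finset.card_le_card (Finset.filter_subset_filter _ (Finset.range_mono h))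

section March

variable {f h : ℕ → ZMod n} {T : ℕ}

theorem march_cases (hn : 2 ≤ n) (hf : ∀ t < T, f (t + 1) = attempt (e t) (f t) 1) {t : ℕ}
    (ht : t < T) :
    (e t = some (f t) ∧ f (t + 1) = f t ∧ moveCount f (t + 1) = moveCount f t) ∨
    (e t ≠ some (f t) ∧ f (t + 1) = f t + 1 ∧ moveCount f (t + 1) = moveCount f t + 1) := by
  have : Fact (1 < n) := ⟨hn⟩
  have h1 : f t + 1 ≠ f t := by simp
  rw [moveCount_succ, hf t ht, attempt_one]
  by_cases h : e t = some (f t)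
  · simp [h]
  · simp [h]

/-- An agent that has moved `n` times forward has acted at every node. -/
theorem march_visits [NeZero n] (hn : 2 ≤ n) (hf : ∀ t < T, f (t + 1) = attempt (e t) (f t) 1)
    (hc : n ≤ moveCount f T) (v : ZMod n) : ∃ t < T, f t = v := by
  -- The number of moves determines the node, and takes all values below `n`.
  have h₁ : ∀ t ≤ T, f t = f 0 + moveCount f t := by
    intro t ht
    induction t with
    | zero => simp [moveCount]
    | succ t ih =>
      have := ih (by omega)
      rcases march_cases hn hf ht with ⟨-, h, h'⟩ | ⟨-, h, h'⟩ <;> rw [h, h', this]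
      push_cast
      ring
  have h₂ : ∀ t ≤ T, ∀ j < moveCount f t, ∃ τ < t, moveCount f τ = j := by
    intro t ht
    induction t with
    | zero => simp [moveCount]
    | succ t ih =>
      intro j hj
      by_cases hj' : j < moveCount f t
      · obtain ⟨τ, hτ, h⟩ := ih (by omega) j hj'
        exact ⟨τ, by omega, h⟩
      · refine ⟨t, t.lt_succ_self, ?_⟩
        rcases march_cases hn hf ht with ⟨-, -, h'⟩ | ⟨-, -, h'⟩ <;> omega
  obtain ⟨τ, hτ, h⟩ := h₂ T le_rfl (v - f 0).val ((ZMod.val_lt _).trans_le hc)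
  refine ⟨τ, hτ, ?_⟩
  rw [h₁ τ hτ.le, h, ZMod.natCast_zmod_val]
  ring

theorem march_together (hf : ∀ t < T, f (t + 1) = attempt (e t) (f t) 1)
    (hh : ∀ t < T, h (t + 1) = attempt (e t) (h t) 1) {t t' : ℕ} (ht : t ≤ t') (ht' : t' ≤ T)
    (heq : f t = h t) : f t' = h t' := by
  induction t', ht using Nat.le_induction with
  | base => exact heq
  | succ t' _ ih => rw [hf t' ht', hh t' ht', ih (by omega)]

/-- If two agents that march forward for `3n` rounds do not end at the same node, then they have
never met and at least one of them has moved in each round. As the distance between them has stayed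
below `n`, each of them has moved at least `n` times. -/
theorem march_apart [NeZero n] (hn : 2 ≤ n) (hT : 3 * n ≤ T)
    (hf : ∀ t < T, f (t + 1) = attempt (e t) (f t) 1)
    (hh : ∀ t < T, h (t + 1) = attempt (e t) (h t) 1) (hne : f T ≠ h T) : n ≤ moveCount f T := by
  have hne' : ∀ t ≤ T, f t ≠ h t := fun t ht heq => hne (march_together hf hh ht le_rfl heq)
  have key : ∀ t ≤ T, (f t - h t).val + moveCount h t = (f 0 - h 0).val + moveCount f t ∧
      t ≤ moveCount f t + moveCount h t := by
    intro t ht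
    induction t with
    | zero => simp [moveCount]
    | succ t ih =>
      obtain ⟨ih₁, ih₂⟩ := ih (by omega)
      rcases march_cases hn hf ht with ⟨b, h₁, h₂⟩ | ⟨b, h₁, h₂⟩ <;>
        rcases march_cases hn hh ht with ⟨b', h₃, h₄⟩ | ⟨b', h₃, h₄⟩
      -- A link blocks forward moves only from one node, and they are at different ones.
      · exact absurd (Option.some.inj (b.symm.trans b')) (hne' t (by omega))
      · rw [h₁, h₂, h₃, h₄, ← sub_sub]
        have := val_sub_one hn (sub_ne_zero.2 (hne' t (by omega)))
        omega
      · have hs := hne' (t + 1) ht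
        rw [h₁, h₃] at hs
        have := val_sub_one hn (sub_ne_zero.2 hs)
        rw [sub_right_comm, add_sub_cancel_right] at this
        rw [h₁, h₂, h₃, h₄]
        omega
      · rw [h₁, h₂, h₃, h₄, add_sub_add_right_eq_sub]
        omega
  obtain ⟨h₁, h₂⟩ := key T le_rfl
  have := ZMod.val_lt (f 0 - h 0)
  omega

end March

end Ring

end PartialGathering

/-! ### The selection phase -/

namespace PartialGathering

section Selection

variable {n k g : ℕ} (X : Scenario n k)

/-- The agents at node `v` with their identifiers and roles `ρ`, in the configuration `p`. -/
def crewOf (ρ : Fin k → Role) (p : Fin k → ZMod n) (v : ZMod n) : Finset (ℕ × Role) :=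
  (Finset.univ.filter fun i => p i = v).image fun i => (X.ids i, ρ i)

variable {ρ : Fin k → Role} {p : Fin k → ZMod n} {v : ZMod n}

theorem card_crewOf : (crewOf X ρ p v).card = agentsAt p v := by
  unfold crewOf agentsAt
  exact Finset.card_image_of_injective _ fun i j h => X.ids_injective (congrArg Prod.fst h)

theorem card_crewOf_filter (i : Fin k) :
    ((crewOf X ρ p (p i)).filter (·.1 ≤ X.ids i)).card = rank X.ids p i := by
  unfold crewOf rank
  rw [Finset.filter_image, Finset.filter_filter]
  exact Finset.card_image_of_injective _ fun i j h => X.ids_injective (congrArg Prod.fst h)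

theorem mem_roles_crewOf {r : Role} :
    r ∈ (crewOf X ρ p v).image Prod.snd ↔ ∃ i, p i = v ∧ ρ i = r := by
  simp [crewOf]

theorem mem_ids_crewOf {j : Fin k} :
    X.ids j ∈ (crewOf X ρ p v).image Prod.fst ↔ p j = v := by
  simp only [crewOf, Finset.mem_image, Finset.mem_filter, Finset.mem_univ, true_and]
  constructor
  · rintro ⟨_, ⟨i, hi, rfl⟩, h⟩
    exact X.ids_injective h ▸ hi
  · exact fun h => ⟨_, ⟨j, h, rfl⟩, rfl⟩

theorem agentsAt_eq_iff : agentsAt p v = k ↔ ∀ i, p i = v := by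
  have h := Finset.card_filter_eq_iff (s := (Finset.univ : Finset (Fin k))) (p := fun i => p i = v)
  rw [Finset.card_fin] at h
  unfold agentsAt
  simpa using h

theorem prelude_lt_horizon : prelude n < horizon n g := by
  unfold horizon
  exact Nat.lt_add_of_pos_right (by positivity)

theorem ids_of_mem_crew {t τ : ℕ} {m : Memory} {x : ℕ × Role}
    (hx : x ∈ crew (past m (boardAt X g t v)) τ) : ∃ j, x.1 = X.ids j := by
  simp only [crew, past, Finset.mem_image, Finset.mem_filter, mem_boardAt] at hx
  obtain ⟨y, ⟨⟨⟨τ', -, j, -, hy⟩, -⟩, -⟩, rfl⟩ := hx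
  refine ⟨j, ?_⟩
  unfold note at hy
  split at hy
  · simp at hy
  · split_ifs at hy
    · rw [Finset.mem_singleton.1 hy]
    · simp at hy

/-- The records of round `0` show which agent has started at a node. -/
theorem start_crew {t : ℕ} (ht : 0 < t) {m : Memory} (hm : m.clock = t) :
    crew (past m (boardAt X g t v)) 0 = crewOf X (fun _ => none) X.start v :=
  crew_past X ht ((Nat.zero_le _).trans_lt (prelude_lt_horizon (n := n)))
    (m := fun i => ⟨0, X.ids i, none, 0⟩) (fun i => stateAt_zero X i) v hm

/-- While marching, an agent remembers the smallest identifier among those that started at a node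
where it has been. -/
theorem selection_invariant : ∀ t ≤ 3 * n, ∃ ld : Fin k → ℕ,
    (∀ i, stateAt X g t i = some ⟨t, ld i, none, 0⟩) ∧ (∀ i, ∃ j, ld i = X.ids j) ∧
    (∀ i, ld i ≤ X.ids i) ∧
    ∀ i j τ, 0 < τ → τ < t → locAt X g τ i = X.start j → ld i ≤ X.ids j := by
  intro t
  induction t with
  | zero =>
    exact fun _ => ⟨X.ids, fun i => stateAt_zero X i, fun i => ⟨i, rfl⟩, fun i => le_rfl,
      fun i j τ _ h => absurd h (Nat.not_lt_zero τ)⟩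
  | succ t ih =>
    intro ht
    obtain ⟨ld, h₁, h₂, h₃, h₄⟩ := ih (by omega)
    have hT : t < horizon n g := lt_trans (by unfold prelude; omega) (prelude_lt_horizon (n := n))
    let c : Fin k → Finset ℕ := fun i => insert (ld i)
      ((crew (past ⟨t, ld i, none, 0⟩ (boardAt X g t (locAt X g t i))) 0).image Prod.fst)
    have hc : ∀ i, (c i).Nonempty := fun i => Finset.insert_nonempty _ _
    have hle : ∀ i, (c i).min' (hc i) ≤ ld i := fun i =>
      Finset.min'_le _ _ (Finset.mem_insert_self _ _)
    refine ⟨fun i => (c i).min' (hc i), fun i => ?_, fun i => ?_, fun i => (hle i).trans (h₃ i),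
      fun i j τ hτ hτt hj => ?_⟩
    · rw [(active_round X hT (h₁ i)).1, update, if_pos (show t < 3 * n by omega)]
      rfl
    · have := Finset.mem_insert.1 ((c i).min'_mem (hc i))
      rcases this with h | h
      · obtain ⟨j, hj⟩ := h₂ i
        exact ⟨j, h.trans hj⟩
      · obtain ⟨x, hx, hx'⟩ := Finset.mem_image.1 h
        obtain ⟨j, hj⟩ := ids_of_mem_crew X hx
        exact ⟨j, hx'.symm.trans hj⟩
    · rcases Nat.lt_succ_iff_lt_or_eq.1 hτt with h | rfl
      · exact (hle i).trans (h₄ i j τ hτ h hj)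
      · refine Finset.min'_le _ _ (Finset.mem_insert_of_mem ?_)
        rw [start_crew X hτ rfl, mem_ids_crewOf, hj]

theorem selection_forward {t : ℕ} (ht : t < 3 * n) (i : Fin k) :
    locAt X g (t + 1) i = attempt (X.missing t) (locAt X g t i) 1 := by
  obtain ⟨ld, h, -⟩ := selection_invariant X (g := g) t ht.le
  have hT : t < horizon n g := lt_trans (by unfold prelude; omega) (prelude_lt_horizon (n := n))
  rw [(active_round X hT (h i)).2, heading, if_pos ht]

/-- The two rounds after the march, in which agents find out whether all of them are together. -/
theorem selection_end : ∃ ld : Fin k → ℕ,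
    (∀ i, ∃ j, ld i = X.ids j) ∧ (∀ i, ld i ≤ X.ids i) ∧
    (∀ i j τ, 0 < τ → τ < 3 * n → locAt X g τ i = X.start j → ld i ≤ X.ids j) ∧
    locAt X g (3 * n + 1) = locAt X g (3 * n) ∧ locAt X g (3 * n + 2) = locAt X g (3 * n) ∧
    ∀ i, stateAt X g (3 * n + 2) i =
      if ∀ j, locAt X g (3 * n) j = locAt X g (3 * n) i then none
      else some ⟨3 * n + 2, ld i, none, 0⟩ := by
  obtain ⟨ld, h₁, h₂, h₃, h₄⟩ := selection_invariant X (g := g) (3 * n) le_rfl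
  have hT : 3 * n + 1 < horizon n g :=
    lt_of_le_of_lt (by unfold prelude; omega) (prelude_lt_horizon (n := n))
  have hr₁ := fun i => active_round X (by omega) (h₁ i)
  have h₁' : ∀ i, stateAt X g (3 * n + 1) i = some ⟨3 * n + 1, ld i, none, 0⟩ := by
    intro i
    rw [(hr₁ i).1, update, if_neg (lt_irrefl _), if_pos (by dsimp only [prelude]; omega),
      if_neg (fun h => by have := h.1; dsimp only at this; omega)]
    rfl
  have hl₁ : locAt X g (3 * n + 1) = locAt X g (3 * n) := by
    funext i
    rw [(hr₁ i).2, heading, if_neg (lt_irrefl _), if_pos (by dsimp only; omega)]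
    rfl
  have hr₂ := fun i => active_round X hT (h₁' i)
  refine ⟨ld, h₂, h₃, h₄, hl₁, ?_, fun i => ?_⟩
  · rw [← hl₁]
    funext i
    rw [(hr₂ i).2, heading, if_neg (by dsimp only; omega), if_pos (by dsimp only; omega)]
    rfl
  · have hcrew : (crew (past ⟨3 * n + 1, ld i, none, 0⟩
        (boardAt X g (3 * n + 1) (locAt X g (3 * n) i))) (3 * n)).card =
        agentsAt (locAt X g (3 * n)) (locAt X g (3 * n) i) := by
      rw [crew_past X (Nat.lt_succ_self _) (by omega) h₁ _ rfl]
      exact card_crewOf X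
    rw [(hr₂ i).1, update, if_neg (by dsimp only; omega), if_pos (by dsimp only [prelude]; omega),
      hl₁]
    dsimp only
    rw [hcrew]
    simp only [true_and, agentsAt_eq_iff]
    split_ifs <;> rfl

/-- The remaining rounds before the splitting, if the agents have not terminated: all of them know
the smallest identifier, and go to the node where that agent has started. -/
theorem gathering_rounds {m : Fin k} {s : ℕ} (hs : 3 * n + 2 ≤ s)
    (h : ∀ i, stateAt X g s i = some ⟨s, X.ids m, none, 0⟩) :
    ∀ t, s ≤ t → t ≤ prelude n →
      (∀ i, stateAt X g t i = some ⟨t, X.ids m, none, 0⟩) ∧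
      (t < prelude n → ∀ i, locAt X g (t + 1) i = if locAt X g t i = X.start m then locAt X g t i
        else attempt (X.missing t) (locAt X g t i) 1) := by
  have hloc : ∀ t, s ≤ t → t < prelude n →
      (∀ i, stateAt X g t i = some ⟨t, X.ids m, none, 0⟩) →
      (∀ i, stateAt X g (t + 1) i = some ⟨t + 1, X.ids m, none, 0⟩) ∧
      ∀ i, locAt X g (t + 1) i = if locAt X g t i = X.start m then locAt X g t i
        else attempt (X.missing t) (locAt X g t i) 1 := by
    intro t hst ht hi
    have hr := fun i => active_round X (ht.trans (prelude_lt_horizon (n := n))) (hi i)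
    refine ⟨fun i => ?_, fun i => ?_⟩
    · rw [(hr i).1, update, if_neg (by dsimp only; omega), if_pos ht,
        if_neg (fun h => by have := h.1; dsimp only at this; omega)]
      rfl
    · rw [(hr i).2, heading, if_neg (by dsimp only; omega), if_neg (by dsimp only; omega),
        if_pos ht, start_crew X (t := t) (by omega) rfl]
      dsimp only
      simp only [mem_ids_crewOf, eq_comm (a := X.start m)]
      split_ifs
      · rfl
      · rfl
  intro t hst
  induction t, hst using Nat.le_induction with
  | base => exact fun hsp => ⟨h, fun ht => (hloc s le_rfl ht h).2⟩
  | succ t hst ih =>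
    intro ht
    have := (hloc t hst ht (ih (by omega)).1).1
    exact ⟨this, fun ht' => (hloc (t + 1) (by omega) ht' this).2⟩

/-- All agents that do not reach their common destination `w` end at the same node. -/
theorem walk_two_nodes [NeZero n] (hn : 2 ≤ n) (e : ℕ → Option (ZMod n)) (w : ZMod n)
    (p : Fin k → ZMod n) {T : ℕ} (hT : 2 * n ≤ T) :
    ∃ u v, ∀ i, walk e w 1 (p i) T = u ∨ walk e w 1 (p i) T = v := by
  by_cases h : ∃ i, walk e w 1 (p i) T ≠ w
  · obtain ⟨i, hi⟩ := h
    refine ⟨w, walk e w 1 (p i) T, fun j => ?_⟩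
    rcases forward_together (e := e) (w := w) (p := p i) (q := p j) hn hT with h | h | h
    · exact absurd h hi
    · exact Or.inl h
    · exact Or.inr h.symm
  · push Not at h
    exact ⟨w, w, fun i => Or.inl (h i)⟩

theorem locAt_eq_walk {w : ZMod n} {d : Fin k → SignType} {s T : ℕ}
    (h : ∀ t, s ≤ t → t < s + T → ∀ i, locAt X g (t + 1) i =
      if locAt X g t i = w then locAt X g t i
      else attempt (X.missing t) (locAt X g t i) (d i)) (i : Fin k) :
    ∀ q ≤ T, locAt X g (s + q) i = walk (fun τ => X.missing (s + τ)) w (d i) (locAt X g s i) q := by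
  intro q
  induction q with
  | zero => exact fun _ => rfl
  | succ q ih =>
    intro hq
    rw [walk_succ, ← ih (by omega), ← h _ (by omega) (by omega), add_assoc]

/-- The selection phase and the walk to the gathering node. The agents have terminated together, or
begin the splitting at no more than two nodes. -/
theorem selection [NeZero n] (hn : 2 ≤ n) (hk : 0 < k) :
    SelectionPhase (splitting n k g) X (3 * n + 2) ∧
    (((∀ i, stateAt X g (3 * n + 2) i = none) ∧
        ∀ i j, locAt X g (3 * n + 2) i = locAt X g (3 * n + 2) j) ∨
      ((∃ m : Fin k → Memory, ∀ i, stateAt X g (prelude n) i = some (m i)) ∧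
        ∃ u v, ∀ i, locAt X g (prelude n) i = u ∨ locAt X g (prelude n) i = v)) := by
  obtain ⟨ld, h₁, h₂, h₃, h₄, h₅, h₆⟩ := selection_end X (g := g)
  have hstay : ∀ t, 3 * n ≤ t → t < 3 * n + 2 → locAt X g (t + 1) = locAt X g t := by
    intro t ht ht'
    obtain rfl | rfl : t = 3 * n ∨ t = 3 * n + 1 := by omega
    · exact h₄
    · exact h₅.trans h₄.symm
  by_cases htog : ∀ i j, locAt X g (3 * n) j = locAt X g (3 * n) i
  · have hterm : ∀ i, stateAt X g (3 * n + 2) i = none := fun i => by rw [h₆, if_pos (htog i)]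
    have hall : ∀ i j, locAt X g (3 * n + 2) i = locAt X g (3 * n + 2) j := fun i j => by
      rw [h₅, htog]
    exact ⟨⟨by omega, fun t ht => selection_forward X ht, hstay, Or.inl ⟨hterm, hall⟩⟩,
      Or.inl ⟨hterm, hall⟩⟩
  · have hapart : ∀ i, ∃ j, locAt X g (3 * n) j ≠ locAt X g (3 * n) i := by
      intro i
      by_contra! h
      exact htog fun i' j => (h j).trans (h i').symm
    have hmoves : ∀ i, n ≤ moveCount (fun t => locAt X g t i) (3 * n) := by
      intro i
      obtain ⟨j, hj⟩ := hapart i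
      exact march_apart (h := fun t => locAt X g t j) hn le_rfl
        (fun t ht => selection_forward X ht i) (fun t ht => selection_forward X ht j) hj.symm
    have hld : ∀ m, (∀ j, X.ids m ≤ X.ids j) → ∀ i, ld i = X.ids m := by
      intro m hm i
      refine le_antisymm ?_ ?_
      · by_cases him : i = m
        · exact him ▸ h₂ i
        -- At time `0` agent `i` is at its own starting node, so that it visits that of `m` later,
        -- when agent `m` has left its record there.
        · obtain ⟨τ, hτ, hv⟩ := march_visits hn (fun t ht => selection_forward X ht i)
            (hmoves i) (X.start m)
          refine h₃ i m τ (Nat.pos_of_ne_zero ?_) hτ hv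
          rintro rfl
          exact him (X.start_injective hv)
      · obtain ⟨j, hj⟩ := h₁ i
        exact hj ▸ hm j
    have hS : ∀ m, (∀ j, X.ids m ≤ X.ids j) →
        ∀ i, stateAt X g (3 * n + 2) i = some ⟨3 * n + 2, X.ids m, none, 0⟩ := by
      intro m hm i
      obtain ⟨j, hj⟩ := hapart i
      rw [h₆, if_neg fun h => hj (h j), hld m hm]
    have hG := fun m hm => gathering_rounds X (s := 3 * n + 2) (m := m) le_rfl (hS m hm)
    constructor
    · refine ⟨by omega, fun t ht => selection_forward X ht, hstay, Or.inr ⟨fun i => ?_, ?_⟩⟩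
      · exact (hmoves i).trans (moveCount_mono _ (by omega))
      · intro m hm t ht ht'
        exact (hG m hm t ht (by unfold prelude; omega)).2 (by unfold prelude; omega)
    · right
      obtain ⟨m, -, hm⟩ := Finset.exists_min_image Finset.univ X.ids ⟨⟨0, hk⟩, Finset.mem_univ _⟩
      have hm' : ∀ j, X.ids m ≤ X.ids j := fun j => hm j (Finset.mem_univ j)
      refine ⟨⟨_, (hG m hm' (prelude n) (by unfold prelude; omega) le_rfl).1⟩, ?_⟩
      have hw := fun i => locAt_eq_walk X (g := g) (s := 3 * n + 2) (T := 3 * n) (w := X.start m)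
        (d := fun _ => 1) (fun t ht ht' =>
          (hG m hm' t ht (by unfold prelude; omega)).2 (by unfold prelude; omega)) i _ le_rfl
      have he : prelude n = 3 * n + 2 + 3 * n := by unfold prelude; omega
      simp only [he, hw]
      exact walk_two_nodes hn _ _ _ (by omega)

end Selection

end PartialGathering

/-! ### Stages of a subphase -/

namespace PartialGathering

section Stages

variable {n k g : ℕ} (X : Scenario n k)

/-- The first round of stage `p` of subphase `j`, both counted from `0`; stage `3` is
stage `0` of the next subphase. -/
def stageStart (n j p : ℕ) : ℕ := prelude n + (3 * j + p) * (n + 2)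

theorem stageStart_succ (j p : ℕ) : stageStart n j (p + 1) = stageStart n j p + 2 + n := by
  unfold stageStart; ring

theorem stageStart_three (j : ℕ) : stageStart n j 3 = stageStart n (j + 1) 0 := by
  unfold stageStart; ring

theorem stageStart_eq (j p : ℕ) : stageStart n j p = stageStart n j 0 + p * (n + 2) := by
  unfold stageStart; ring

theorem offset_stageStart {j p q : ℕ} (hq : q < n + 2) : offset n (stageStart n j p + q) = q := by
  unfold offset stageStart
  rw [add_assoc, Nat.add_sub_cancel_left, Nat.mul_add_mod_self_right, Nat.mod_eq_of_lt hq]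

theorem stage_stageStart {j p q : ℕ} (hp : p < 3) (hq : q < n + 2) :
    stage n (stageStart n j p + q) = p := by
  unfold stage stageStart
  rw [add_assoc, Nat.add_sub_cancel_left, mul_comm, Nat.mul_add_div (by omega),
    Nat.div_eq_of_lt hq]
  omega

theorem decision_clock (a p s t : ℕ) (m : Memory) (c₀ c : Finset (ℕ × Role)) :
    (decision k g a p { m with clock := s } c₀ c).map (fun m' => { m' with clock := t }) =
      (decision k g a p m c₀ c).map fun m' => { m' with clock := t } := by
  unfold decision
  split_ifs <;> rfl

variable {j p : ℕ}

section

variable (hp : p < 3) (hT : stageStart n j (p + 1) ≤ horizon n g) {m₀ m : Fin k → Memory}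
  (hm₀ : ∀ i, stateAt X g (stageStart n j 0) i = some (m₀ i))
  (hm : ∀ i, stateAt X g (stageStart n j p) i = some (m i))

include hp hT hm₀ hm in
/-- What agents read in a stage about the first rounds of the subphase and of the stage. -/
theorem stage_crews {q : ℕ} (hq : q < n + 2) (hq' : 0 < q) {m' : Memory}
    (hm' : m'.clock = stageStart n j p + q) (v : ZMod n) :
    subphaseCrew n m'.clock (past m' (boardAt X g (stageStart n j p + q) v)) =
        crewOf X (fun i => (m₀ i).role) (locAt X g (stageStart n j 0)) v ∧
      stageCrew n m'.clock (past m' (boardAt X g (stageStart n j p + q) v)) =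
        crewOf X (fun i => (m i).role) (locAt X g (stageStart n j p)) v := by
  have hs := stageStart_succ (n := n) j p
  have h0 := stageStart_eq (n := n) j p
  unfold subphaseCrew stageCrew
  rw [hm', offset_stageStart hq, stage_stageStart hp hq, Nat.add_sub_cancel]
  constructor
  · rw [show stageStart n j p - p * (n + 2) = stageStart n j 0 by rw [h0, Nat.add_sub_cancel]]
    exact crew_past X (by omega) (by omega) hm₀ v hm'
  · exact crew_past X (by omega) (by omega) hm v hm'

include hp hT hm₀ hm in
/-- The first two rounds of a stage, in which nobody moves. -/
theorem stage_begin :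
    locAt X g (stageStart n j p + 1) = locAt X g (stageStart n j p) ∧
    locAt X g (stageStart n j p + 2) = locAt X g (stageStart n j p) ∧
    ∀ i, stateAt X g (stageStart n j p + 2) i = (decision k g (X.ids i) p (m i)
        (crewOf X (fun i => (m₀ i).role) (locAt X g (stageStart n j 0))
          (locAt X g (stageStart n j p) i))
        (crewOf X (fun i => (m i).role) (locAt X g (stageStart n j p))
          (locAt X g (stageStart n j p) i))).map
      fun m' => { m' with clock := stageStart n j p + 2 } := by
  have hs := stageStart_succ (n := n) j p
  have hge : prelude n ≤ stageStart n j p := Nat.le_add_right _ _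
  have hpre : prelude n = 6 * n + 2 := rfl
  have hc := fun i => stateAt_clock X (hm i)
  have ho₀ : offset n (stageStart n j p) = 0 := offset_stageStart (q := 0) (by omega)
  have ho₁ : offset n (stageStart n j p + 1) = 1 := offset_stageStart (by omega)
  have hr₁ := fun i => active_round X (by omega) (hm i)
  have h₁ : ∀ i, stateAt X g (stageStart n j p + 1) i =
      some { m i with clock := stageStart n j p + 1 } := by
    intro i
    rw [(hr₁ i).1, update, hc, if_neg (by omega), if_neg (by omega), if_neg (by omega)]
    rfl
  have hl₁ : locAt X g (stageStart n j p + 1) = locAt X g (stageStart n j p) := by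
    funext i
    rw [(hr₁ i).2, heading, hc, if_neg (by omega), if_neg (by omega), if_neg (by omega),
      if_pos (by omega)]
    rfl
  have hr₂ := fun i => active_round X (by omega) (h₁ i)
  refine ⟨hl₁, ?_, fun i => ?_⟩
  · rw [← hl₁]
    funext i
    rw [(hr₂ i).2, heading, if_neg (by dsimp only; omega), if_neg (by dsimp only; omega),
      if_neg (by dsimp only; omega), if_pos (by dsimp only; omega)]
    rfl
  · have hcr := stage_crews X hp hT hm₀ hm (q := 1) (by omega) (by omega)
      (m' := { m i with clock := stageStart n j p + 1 }) rfl (locAt X g (stageStart n j p) i)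
    rw [(hr₂ i).1, update, if_neg (by dsimp only; omega), if_neg (by dsimp only; omega),
      if_pos (by dsimp only; omega), hl₁, hcr.1, hcr.2, stage_stageStart hp (by omega)]
    exact decision_clock _ _ _ _ _ _ _

include hp hT hm₀ hm in
/-- The remaining rounds of a stage, in which agents move in the direction on which they have
decided unless they are at a node where they stop. -/
theorem stage_moves {m' : Fin k → Memory}
    (hdec : ∀ i, decision k g (X.ids i) p (m i)
        (crewOf X (fun i => (m₀ i).role) (locAt X g (stageStart n j 0))
          (locAt X g (stageStart n j p) i))
        (crewOf X (fun i => (m i).role) (locAt X g (stageStart n j p))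
          (locAt X g (stageStart n j p) i)) = some (m' i)) :
    (∀ q ≤ n, ∀ i, stateAt X g (stageStart n j p + 2 + q) i =
      some { m' i with clock := stageStart n j p + 2 + q }) ∧
    ∀ q < n, ∀ i, locAt X g (stageStart n j p + 2 + q + 1) i =
      attempt (X.missing (stageStart n j p + 2 + q)) (locAt X g (stageStart n j p + 2 + q) i)
        (if Halt g p (crewOf X (fun i => (m₀ i).role) (locAt X g (stageStart n j 0))
              (locAt X g (stageStart n j p + 2 + q) i))
            (crewOf X (fun i => (m i).role) (locAt X g (stageStart n j p))
              (locAt X g (stageStart n j p + 2 + q) i))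
          then 0 else (m' i).dir) := by
  have hs := stageStart_succ (n := n) j p
  have hge : prelude n ≤ stageStart n j p := Nat.le_add_right _ _
  have hpre : prelude n = 6 * n + 2 := rfl
  have hst : ∀ q ≤ n, ∀ i, stateAt X g (stageStart n j p + 2 + q) i =
      some { m' i with clock := stageStart n j p + 2 + q } := by
    intro q hq
    induction q with
    | zero =>
      intro i
      rw [add_zero, (stage_begin X hp hT hm₀ hm).2.2 i, hdec]
      rfl
    | succ q ih =>
      intro i
      have ho : offset n (stageStart n j p + 2 + q) = 2 + q := by
        rw [add_assoc, offset_stageStart (by omega)]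
      rw [← add_assoc, (active_round X (by omega) (ih (by omega) i)).1, update,
        if_neg (by dsimp only; omega), if_neg (by dsimp only; omega),
        if_neg (by dsimp only; omega)]
      rfl
  refine ⟨hst, fun q hq i => ?_⟩
  have ho : offset n (stageStart n j p + 2 + q) = 2 + q := by
    rw [add_assoc, offset_stageStart (by omega)]
  have hcr := stage_crews X hp hT hm₀ hm (q := 2 + q) (by omega) (by omega)
    (m' := { m' i with clock := stageStart n j p + 2 + q }) (add_assoc _ _ _)
    (locAt X g (stageStart n j p + 2 + q) i)
  rw [← add_assoc] at hcr
  have hstage : stage n (stageStart n j p + 2 + q) = p := by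
    rw [add_assoc, stage_stageStart hp (by omega)]
  rw [(active_round X (by omega) (hst q hq.le i)).2, heading,
    if_neg (by dsimp only; omega), if_neg (by dsimp only; omega),
    if_neg (by dsimp only; omega), if_neg (by dsimp only; omega), hcr.1, hcr.2, hstage]

include hp hT hm₀ hm in
/-- The outcome of a stage in which agents stop at a single node. -/
theorem stage_walk {m' : Fin k → Memory}
    (hdec : ∀ i, decision k g (X.ids i) p (m i)
        (crewOf X (fun i => (m₀ i).role) (locAt X g (stageStart n j 0))
          (locAt X g (stageStart n j p) i))
        (crewOf X (fun i => (m i).role) (locAt X g (stageStart n j p))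
          (locAt X g (stageStart n j p) i)) = some (m' i))
    {w : ZMod n}
    (hw : (∀ i, (m' i).dir = 0) ∨
      ∀ y, Halt g p (crewOf X (fun i => (m₀ i).role) (locAt X g (stageStart n j 0)) y)
        (crewOf X (fun i => (m i).role) (locAt X g (stageStart n j p)) y) ↔ y = w) :
    (∀ i, stateAt X g (stageStart n j (p + 1)) i =
      some { m' i with clock := stageStart n j (p + 1) }) ∧
    (∀ t, stageStart n j p + 2 ≤ t → t < stageStart n j p + 2 + n → ∀ i,
      locAt X g (t + 1) i = if locAt X g t i = w then locAt X g t i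
        else attempt (X.missing t) (locAt X g t i) (m' i).dir) ∧
    ∀ i, locAt X g (stageStart n j (p + 1)) i =
      walk (fun τ => X.missing (stageStart n j p + 2 + τ)) w (m' i).dir
        (locAt X g (stageStart n j p) i) n := by
  have h := stage_moves X hp hT hm₀ hm hdec
  have h' : ∀ t, stageStart n j p + 2 ≤ t → t < stageStart n j p + 2 + n → ∀ i,
      locAt X g (t + 1) i = if locAt X g t i = w then locAt X g t i
        else attempt (X.missing t) (locAt X g t i) (m' i).dir := by
    intro t ht ht' i
    obtain ⟨q, rfl⟩ := Nat.exists_eq_add_of_le ht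
    rw [h.2 q (by omega) i]
    rcases hw with hw | hw
    · rw [hw, ite_self, attempt_zero, ite_self]
    · simp only [hw]
      split_ifs <;> rfl
  refine ⟨?_, h', fun i => ?_⟩
  · rw [stageStart_succ]
    exact h.1 n le_rfl
  · rw [stageStart_succ, locAt_eq_walk X h' i n le_rfl, (stage_begin X hp hT hm₀ hm).2.1]

end

end Stages

/-! ### Sizes of the groups -/

section Counting

variable {n k : ℕ} {ids : Fin k → ℕ} {p : Fin k → ZMod n} {g : ℕ} {u : ZMod n}

/-- The ranks of `N` agents at a node are `1, …, N`. -/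
theorem card_rank (hids : Function.Injective ids) (Q : ℕ → Prop) [DecidablePred Q] :
    (Finset.univ.filter fun i => p i = u ∧ Q (rank ids p i)).card =
      ((Finset.Icc 1 (agentsAt p u)).filter Q).card := by
  have hle : ∀ i j, p i = u → p j = u → ids i < ids j → rank ids p i < rank ids p j := by
    intro i j hi hj hij
    refine Finset.card_lt_card (Finset.ssubset_iff_of_subset ?_ |>.2 ⟨j, ?_, ?_⟩)
    · intro x
      simp only [Finset.mem_filter, Finset.mem_univ, true_and, hi, hj]
      exact fun h => ⟨h.1, h.2.trans hij.le⟩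
    · simp
    · simp [hij]
  have hinj : Set.InjOn (rank ids p) (Finset.univ.filter fun i => p i = u : Finset (Fin k)) := by
    intro i hi j hj h
    simp only [Finset.coe_filter, Finset.mem_univ, true_and, Set.mem_ofPred_eq] at hi hj
    rcases lt_trichotomy (ids i) (ids j) with h' | h' | h'
    · exact absurd h (hle i j hi hj h').ne
    · exact hids h'
    · exact absurd h (hle j i hj hi h').ne'
  have himg : (Finset.univ.filter fun i => p i = u).image (rank ids p) =
      Finset.Icc 1 (agentsAt p u) := by
    refine Finset.eq_of_subset_of_card_le ?_ ?_
    · intro x hx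
      simp only [Finset.mem_image, Finset.mem_filter, Finset.mem_univ, true_and] at hx
      obtain ⟨i, hi, rfl⟩ := hx
      rw [Finset.mem_Icc]
      constructor
      · exact Finset.card_pos.2 ⟨i, by simp⟩
      · refine Finset.card_le_card fun x => ?_
        simp only [Finset.mem_filter, Finset.mem_univ, true_and, hi]
        exact fun h => h.1
    · rw [Finset.card_image_of_injOn hinj, Nat.card_Icc]
      exact le_rfl
  rw [← himg, Finset.filter_image, Finset.filter_filter, Finset.card_image_of_injOn]
  refine hinj.mono fun i => ?_
  simp only [Finset.coe_filter, Finset.mem_univ, true_and, Set.mem_ofPred_eq]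
  exact fun h => h.1

theorem splitDir_eq_zero_iff (i : Fin k) : splitDir g ids p i = 0 ↔ rank ids p i ≤ g := by
  unfold splitDir
  split_ifs with h h' <;> simp [h]

theorem splitDir_eq_one_iff (i : Fin k) : splitDir g ids p i = 1 ↔
    g < rank ids p i ∧ rank ids p i ≤ g + (agentsAt p (p i) - g) / 2 := by
  unfold splitDir
  split_ifs with h h'
  · simp; omega
  · simp; omega
  · simp; omega

theorem splitDir_eq_neg_one_iff (i : Fin k) : splitDir g ids p i = -1 ↔
    g + (agentsAt p (p i) - g) / 2 < rank ids p i := by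
  unfold splitDir
  split_ifs with h h'
  · simp; omega
  · simp; omega
  · simp; omega

theorem card_anchors (hids : Function.Injective ids) (hg : g ≤ agentsAt p u) :
    (Finset.univ.filter fun i => p i = u ∧ splitDir g ids p i = 0).card = g := by
  simp only [splitDir_eq_zero_iff]
  rw [card_rank hids (· ≤ g)]
  have : (Finset.Icc 1 (agentsAt p u)).filter (· ≤ g) = Finset.Icc 1 g := by
    ext x; simp only [Finset.mem_filter, Finset.mem_Icc]; omega
  rw [this, Nat.card_Icc, Nat.add_sub_cancel]

/-- Each of the two groups that leave a node has at least half of the agents in excess of `g`,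
rounded down. -/
theorem le_card_group (hids : Function.Injective ids) {r : SignType} (hr : r = 1 ∨ r = -1)
    (hg : g ≤ agentsAt p u) : (agentsAt p u - g) / 2 ≤
      (Finset.univ.filter fun i => p i = u ∧ splitDir g ids p i = r).card := by
  rcases hr with rfl | rfl
  · have : (Finset.univ.filter fun i => p i = u ∧ splitDir g ids p i = 1) =
        Finset.univ.filter fun i => p i = u ∧
          (g < rank ids p i ∧ rank ids p i ≤ g + (agentsAt p u - g) / 2) := by
      refine Finset.filter_congr fun i _ => and_congr_right fun hi => ?_
      rw [splitDir_eq_one_iff, hi]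
    rw [this, card_rank hids (fun x => g < x ∧ x ≤ g + (agentsAt p u - g) / 2)]
    have : (Finset.Icc 1 (agentsAt p u)).filter (fun x => g < x ∧ x ≤ g + (agentsAt p u - g) / 2) =
        Finset.Icc (g + 1) (g + (agentsAt p u - g) / 2) := by
      ext x; simp only [Finset.mem_filter, Finset.mem_Icc]; omega
    rw [this, Nat.card_Icc]
    omega
  · have : (Finset.univ.filter fun i => p i = u ∧ splitDir g ids p i = -1) =
        Finset.univ.filter fun i => p i = u ∧ g + (agentsAt p u - g) / 2 < rank ids p i := by
      refine Finset.filter_congr fun i _ => and_congr_right fun hi => ?_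
      rw [splitDir_eq_neg_one_iff, hi]
    rw [this, card_rank hids (fun x => g + (agentsAt p u - g) / 2 < x)]
    have : (Finset.Icc 1 (agentsAt p u)).filter (fun x => g + (agentsAt p u - g) / 2 < x) =
        Finset.Icc (g + (agentsAt p u - g) / 2 + 1) (agentsAt p u) := by
      ext x; simp only [Finset.mem_filter, Finset.mem_Icc]; omega
    rw [this, Nat.card_Icc]
    omega

end Counting

end PartialGathering

/-! ### The groups of a subphase -/

namespace PartialGathering

section Formations

variable {n k g : ℕ} {p : Fin k → ZMod n} {u v : ZMod n}

/-- The agents are at two nodes `u` and `v`, and fewer than `g` of them are at `v`. -/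
structure Lacking (g : ℕ) (p : Fin k → ZMod n) (u v : ZMod n) : Prop where
  ne : u ≠ v
  mem : ∀ i, p i = u ∨ p i = v
  pos : 0 < agentsAt p v
  lt : agentsAt p v < g
  add : agentsAt p u + agentsAt p v = k

theorem agentsAt_pos_iff {y : ZMod n} : 0 < agentsAt p y ↔ ∃ i, p i = y := by
  unfold agentsAt
  rw [Finset.card_pos]
  simp [Finset.Nonempty]

theorem deficit_eq_zero_iff : deficit g p = 0 ↔ ∀ i, g ≤ agentsAt p (p i) := by
  unfold deficit
  rw [← Nat.bot_eq_zero, Finset.sup_eq_bot_iff]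
  simp [Nat.sub_eq_zero_iff_le]

theorem exists_lacking {a b : ZMod n} (hab : ∀ i, p i = a ∨ p i = b) (hgk : g ≤ k)
    (hpos : 0 < agentsAt p v) (hlt : agentsAt p v < g) : ∃ u, Lacking g p u v := by
  have key : ∀ u, (∀ i, p i = u ∨ p i = v) → Lacking g p u v := by
    intro u hu
    have hne : u ≠ v := by
      rintro rfl
      have := agentsAt_eq_iff.2 fun i => or_self_iff.1 (hu i)
      omega
    refine ⟨hne, hu, hpos, hlt, ?_⟩
    have h := Finset.card_filter_add_card_filter_not (s := (Finset.univ : Finset (Fin k)))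
      (fun i => p i = u)
    rw [Finset.card_fin] at h
    have hv : (Finset.univ.filter fun i => p i = v) = Finset.univ.filter fun i => ¬p i = u :=
      Finset.filter_congr fun i _ =>
        ⟨fun h₁ h₂ => hne (h₂.symm.trans h₁), fun h => (hu i).resolve_left h⟩
    unfold agentsAt
    rw [hv, h]
  obtain ⟨i, hi⟩ := agentsAt_pos_iff.1 hpos
  rcases hab i with h | h
  · exact ⟨b, key b fun j => hi ▸ h ▸ (hab j).symm⟩
  · exact ⟨a, key a fun j => hi ▸ h ▸ hab j⟩

theorem Lacking.low_iff (h : Lacking g p u v) (hk : 2 * g + 1 ≤ k) (y : ZMod n) :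
    (0 < agentsAt p y ∧ agentsAt p y < g) ↔ y = v := by
  constructor
  · rintro ⟨h₁, h₂⟩
    obtain ⟨i, rfl⟩ := agentsAt_pos_iff.1 h₁
    refine (h.mem i).resolve_left fun hi => ?_
    rw [hi] at h₂
    have := h.add
    have := h.lt
    omega
  · rintro rfl
    exact ⟨h.pos, h.lt⟩

theorem Lacking.high_iff (h : Lacking g p u v) (hk : 2 * g + 1 ≤ k) (y : ZMod n) :
    g ≤ agentsAt p y ↔ y = u := by
  have := h.add
  have := h.lt
  constructor
  · intro h₁
    obtain ⟨i, rfl⟩ := agentsAt_pos_iff.1 (show 0 < agentsAt p y by omega)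
    refine (h.mem i).resolve_right fun hi => ?_
    rw [hi] at h₁
    omega
  · rintro rfl
    omega

/-- The roles in a subphase that starts with configuration `p`, where `v` lacks agents. -/
def roles (g : ℕ) (ids : Fin k → ℕ) (p : Fin k → ZMod n) (v : ZMod n) (i : Fin k) : Role :=
  if p i = v then none else some (splitDir g ids p i)

/-- In configuration `q`, the anchors are at `a`, the group sent in direction `r` is at `c`, and at
`b` are the group sent in the other direction and the agents that were at `v`. -/
def Formation (g : ℕ) (ids : Fin k → ℕ) (p : Fin k → ZMod n) (v : ZMod n) (r : SignType)
    (q : Fin k → ZMod n) (a b c : ZMod n) : Prop :=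
  ∀ i, q i = if p i = v then b else if splitDir g ids p i = 0 then a
    else if splitDir g ids p i = r then c else b

variable {ids : Fin k → ℕ} {r : SignType}

theorem signType_cases (hr : r = 1 ∨ r = -1) (d : SignType) : d = 0 ∨ d = r ∨ d = -r := by
  revert hr
  revert r d
  decide

theorem signType_ne (hr : r = 1 ∨ r = -1) : r ≠ 0 ∧ -r ≠ 0 ∧ -r ≠ r := by
  revert hr
  revert r
  decide

theorem Lacking.exists_role (h : Lacking g p u v) (hids : Function.Injective ids)
    (hk : 2 * g + 1 ≤ k) (d : SignType) : ∃ i, p i ≠ v ∧ splitDir g ids p i = d := by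
  have hadd := h.add
  have hlt := h.lt
  have hpos : 0 < (Finset.univ.filter fun i => p i = u ∧ splitDir g ids p i = d).card := by
    rcases signType_cases (Or.inl rfl) d with rfl | hd | hd
    · rw [card_anchors hids (by omega)]
      omega
    · exact lt_of_lt_of_le (by omega) (le_card_group hids (Or.inl hd) (by omega))
    · exact lt_of_lt_of_le (by omega) (le_card_group hids (Or.inr hd) (by omega))
  obtain ⟨i, hi⟩ := Finset.card_pos.1 hpos
  simp only [Finset.mem_filter, Finset.mem_univ, true_and] at hi
  exact ⟨i, hi.1 ▸ h.ne, hi.2⟩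

section

variable (X : Scenario n k) {q : Fin k → ZMod n} {a b c : ZMod n}
  (h : Lacking g p u v) (hk : 2 * g + 1 ≤ k) (hr : r = 1 ∨ r = -1)
  (hq : Formation g X.ids p v r q a b c)

include h hq in
theorem none_mem_roles (y : ZMod n) :
    none ∈ (crewOf X (roles g X.ids p v) q y).image Prod.snd ↔ y = b := by
  rw [mem_roles_crewOf]
  constructor
  · rintro ⟨i, rfl, hi⟩
    unfold roles at hi
    split_ifs at hi with h'
    rw [hq, if_pos h']
  · rintro rfl
    obtain ⟨i, hi⟩ := agentsAt_pos_iff.1 h.pos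
    exact ⟨i, by rw [hq, if_pos hi], by rw [roles, if_pos hi]⟩

theorem some_mem_roles_iff {d : SignType} (y : ZMod n) :
    some d ∈ (crewOf X (roles g X.ids p v) q y).image Prod.snd ↔
      ∃ i, p i ≠ v ∧ splitDir g X.ids p i = d ∧ q i = y := by
  rw [mem_roles_crewOf]
  refine exists_congr fun i => ?_
  unfold roles
  split_ifs with h'
  · simp [h']
  · simp only [Option.some.injEq, ne_eq, h', not_false_eq_true, true_and]
    exact and_comm

include h hk hr hq in
theorem dir_mem_roles (y : ZMod n) :
    some r ∈ (crewOf X (roles g X.ids p v) q y).image Prod.snd ↔ y = c := by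
  rw [some_mem_roles_iff]
  have hq' : ∀ i, p i ≠ v → splitDir g X.ids p i = r → q i = c := fun i h₁ h₂ => by
    rw [hq, if_neg h₁, if_neg (h₂ ▸ (signType_ne hr).1), if_pos h₂]
  constructor
  · rintro ⟨i, h₁, h₂, rfl⟩
    exact hq' i h₁ h₂
  · rintro rfl
    obtain ⟨i, h₁, h₂⟩ := h.exists_role X.ids_injective hk r
    exact ⟨i, h₁, h₂, hq' i h₁ h₂⟩

include h hk hr hq in
theorem neg_dir_mem_roles (y : ZMod n) :
    some (-r) ∈ (crewOf X (roles g X.ids p v) q y).image Prod.snd ↔ y = b := by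
  rw [some_mem_roles_iff]
  have hq' : ∀ i, p i ≠ v → splitDir g X.ids p i = -r → q i = b := fun i h₁ h₂ => by
    rw [hq, if_neg h₁, h₂, if_neg (signType_ne hr).2.1, if_neg (signType_ne hr).2.2]
  constructor
  · rintro ⟨i, h₁, h₂, rfl⟩
    exact hq' i h₁ h₂
  · rintro rfl
    obtain ⟨i, h₁, h₂⟩ := h.exists_role X.ids_injective hk (-r)
    exact ⟨i, h₁, h₂, hq' i h₁ h₂⟩

include h hk hr hq in
/-- The agents at `b` find out whether the group `r` is there. -/
theorem missingDir_eq :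
    missingDir (crewOf X (roles g X.ids p v) q b) = if c = b then 0 else r := by
  have h₁ := dir_mem_roles X h hk hr hq b
  have h₂ := neg_dir_mem_roles X h hk hr hq b
  unfold missingDir
  rcases hr with rfl | rfl
  · simp only [h₁, h₂, if_true, eq_comm (a := b)]
  · rw [neg_neg] at h₂
    simp only [h₁, h₂, if_true, eq_comm (a := b)]

include h hk hr hq in
/-- If the group `r` has joined others, then at most two nodes are occupied and the deficit is
halved: there are `g` anchors, and at `b` there are enough additional agents. -/
theorem Formation.halve (hids : Function.Injective X.ids) (hc : c = a ∨ c = b) :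
    (∀ i, q i = a ∨ q i = b) ∧ 2 * deficit g q ≤ deficit g p := by
  have hadd := h.add
  have hlt := h.lt
  have hmem : ∀ i, q i = a ∨ q i = b := by
    intro i
    rw [hq]
    split_ifs
    · exact Or.inr rfl
    · exact Or.inl rfl
    · exact hc
    · exact Or.inr rfl
  refine ⟨hmem, ?_⟩
  have hne : ∀ i, p i = u → p i ≠ v := fun i hi hv => h.ne (hi.symm.trans hv)
  have ha : g ≤ agentsAt q a := by
    rw [← card_anchors (p := p) (u := u) (g := g) hids (by omega)]
    refine Finset.card_le_card fun i => ?_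
    simp only [Finset.mem_filter, Finset.mem_univ, true_and]
    rintro ⟨h₁, h₂⟩
    rw [hq, if_neg (hne i h₁), if_pos h₂]
  have hb : agentsAt p v + (agentsAt p u - g) / 2 ≤ agentsAt q b := by
    have hgr := le_card_group (p := p) (u := u) (g := g) hids (r := -r)
      (by rcases hr with rfl | rfl <;> simp) (by omega)
    refine (Nat.add_le_add_left hgr _).trans ?_
    unfold agentsAt
    rw [← Finset.card_union_of_disjoint]
    · refine Finset.card_le_card fun i => ?_
      simp only [Finset.mem_union, Finset.mem_filter, Finset.mem_univ, true_and]
      rintro (h₁ | ⟨h₁, h₂⟩)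
      · rw [hq, if_pos h₁]
      · rw [hq, if_neg (hne i h₁), h₂, if_neg (signType_ne hr).2.1, if_neg (signType_ne hr).2.2]
    · refine Finset.disjoint_filter.2 fun i _ h₁ h₂ => hne i h₂.1 h₁
  have hp : g - agentsAt p v ≤ deficit g p := by
    obtain ⟨i, hi⟩ := agentsAt_pos_iff.1 h.pos
    have := Finset.le_sup (f := fun i => g - agentsAt p (p i)) (Finset.mem_univ i)
    rw [hi] at this
    exact this
  have hdq : deficit g q ≤ (g - agentsAt p v) / 2 := by
    refine Finset.sup_le fun i _ => ?_
    rcases hmem i with hi | hi <;> rw [hi] <;> omega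
  omega

end

end Formations

end PartialGathering

/-! ### A subphase -/

namespace PartialGathering

section Subphase

variable {n k g : ℕ} (X : Scenario n k) {j : ℕ}

theorem departure_crewOf {ρ : Fin k → Role} {p : Fin k → ZMod n} (i : Fin k) :
    departure g (X.ids i) (crewOf X ρ p (p i)) = splitDir g X.ids p i := by
  unfold departure splitDir
  rw [card_crewOf_filter, card_crewOf]

/-- A subphase that starts without deficit: all agents find that out, and terminate. -/
theorem subphase_finish (hT : stageStart n j 1 ≤ horizon n g)
    {m : Fin k → Memory} (hm : ∀ i, stateAt X g (stageStart n j 0) i = some (m i))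
    (hd : deficit g (locAt X g (stageStart n j 0)) = 0) :
    (∀ i, stateAt X g (stageStart n j 0 + 2) i = none) ∧
      locAt X g (stageStart n j 0 + 1) = locAt X g (stageStart n j 0) ∧
      locAt X g (stageStart n j 0 + 2) = locAt X g (stageStart n j 0) := by
  obtain ⟨h₁, h₂, h₃⟩ := stage_begin X (p := 0) (by omega) hT hm hm
  refine ⟨fun i => ?_, h₁, h₂⟩
  set p := locAt X g (stageStart n j 0) with hp
  have hge := deficit_eq_zero_iff.1 hd
  have hcond : g ≤ agentsAt p (p i) ∧ (agentsAt p (p i) = k ∨ g ≤ k - agentsAt p (p i)) := by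
    refine ⟨hge i, or_iff_not_imp_left.2 fun hne => ?_⟩
    rw [agentsAt_eq_iff] at hne
    push Not at hne
    obtain ⟨i', hi'⟩ := hne
    have hdisj : agentsAt p (p i) + agentsAt p (p i') ≤ k := by
      unfold agentsAt
      rw [← Finset.card_union_of_disjoint]
      · exact (Finset.card_le_univ _).trans_eq (Fintype.card_fin k)
      · exact Finset.disjoint_filter.2 fun x _ h₁ h₂ => hi' (h₂.symm.trans h₁)
    have := hge i'
    omega
  rw [h₃ i, decision, if_pos rfl, card_crewOf, if_pos hcond]
  rfl

/-- A subphase that starts with a deficit. After the splitting, one of the two groups is at `v`. If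
the other one, sent in direction `r`, is stranded, it turns back to `u`, while all agents at `v` go
to `u` in direction `r`. If only the latter arrive there, then everyone at `u` knows which group is
stranded; the anchors follow it in direction `r`, and the others go to meet it in direction `-r`. -/
theorem subphase_split [NeZero n] (hn : 2 ≤ n) (hk : 2 * g + 1 ≤ k)
    (hT : stageStart n (j + 1) 0 ≤ horizon n g)
    {m : Fin k → Memory} (hm : ∀ i, stateAt X g (stageStart n j 0) i = some (m i)) {u v : ZMod n}
    (h : Lacking g (locAt X g (stageStart n j 0)) u v) :
    (locAt X g (stageStart n j 0 + 1) = locAt X g (stageStart n j 0) ∧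
      locAt X g (stageStart n j 0 + 2) = locAt X g (stageStart n j 0)) ∧
    (∀ t, stageStart n j 0 + 2 ≤ t → t < stageStart n j 0 + 2 + n → ∀ i,
      locAt X g (t + 1) i = if locAt X g t i = v then v
        else attempt (X.missing t) (locAt X g t i)
          (splitDir g X.ids (locAt X g (stageStart n j 0)) i)) ∧
    (∃ m' : Fin k → Memory, ∀ i, stateAt X g (stageStart n (j + 1) 0) i = some (m' i)) ∧
    (∃ a b, ∀ i, locAt X g (stageStart n (j + 1) 0) i = a ∨
      locAt X g (stageStart n (j + 1) 0) i = b) ∧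
    2 * deficit g (locAt X g (stageStart n (j + 1) 0)) ≤
      deficit g (locAt X g (stageStart n j 0)) := by
  rw [← stageStart_three] at hT ⊢
  have hs₀ := stageStart_succ (n := n) j 0
  have hs₁ := stageStart_succ (n := n) j 1
  have hs₂ := stageStart_succ (n := n) j 2
  simp only [zero_add, Nat.reduceAdd] at hs₀ hs₁ hs₂
  have hT₁ : stageStart n j (0 + 1) ≤ horizon n g := by
    simp only [zero_add]
    omega
  have hb := stage_begin X (p := 0) (by omega) hT₁ hm hm
  refine ⟨⟨hb.1, hb.2.1⟩, ?_⟩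
  set p := locAt X g (stageStart n j 0) with hp
  have hadd := h.add
  have hlt := h.lt
  -- The groups walk from `u` to `v`; `x` is where the group sent in direction `r` ends.
  have hdec₀ : ∀ i, decision k g (X.ids i) 0 (m i) (crewOf X (fun i => (m i).role) p (p i))
      (crewOf X (fun i => (m i).role) p (p i)) =
        some { m i with role := roles g X.ids p v i, dir := splitDir g X.ids p i } := by
    intro i
    have hlow := h.low_iff hk (p i)
    rw [decision, if_pos rfl, card_crewOf, departure_crewOf, roles]
    rcases h.mem i with hi | hi
    · rw [if_neg, if_neg, if_neg]
      · rw [hi]; exact h.ne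
      · rw [hi]; omega
      · rw [hi]; have := h.pos; omega
    · rw [if_neg, if_pos, if_pos hi]
      · rwa [hi]
      · rw [hi]; omega
  obtain ⟨hm₁, hl₁, hw₁⟩ := stage_walk X (p := 0) (by omega) hT₁ hm hm hdec₀ (w := v)
    (Or.inr fun y => by rw [Halt, if_pos rfl, card_crewOf]; exact h.low_iff hk y)
  refine ⟨fun t ht ht' i => ?_, ?_⟩
  · rw [hl₁ t ht ht' i]
    split_ifs with hv
    · exact hv
    · rfl
  simp only [zero_add, ← hp] at hm₁ hw₁
  set e₁ : ℕ → Option (ZMod n) := fun τ => X.missing (stageStart n j 0 + 2 + τ)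
  obtain ⟨r, hr, hrv⟩ : ∃ r : SignType, (r = 1 ∨ r = -1) ∧ walk e₁ v (-r) u n = v := by
    rcases splitting_arrives hn e₁ u v with h' | h'
    · exact ⟨-1, Or.inr rfl, h'⟩
    · exact ⟨1, Or.inl rfl, h'⟩
  obtain ⟨hr₀, hr₁, hr₂⟩ := signType_ne hr
  set x := walk e₁ v r u n with hx
  set q₁ := locAt X g (stageStart n j 1) with hq₁
  have hF₁ : Formation g X.ids p v r q₁ u v x := by
    intro i
    rw [hw₁ i]
    by_cases hi : p i = v
    · rw [if_pos hi, hi, walk_self]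
    · rw [if_neg hi, (h.mem i).resolve_right hi]
      rcases signType_cases hr (splitDir g X.ids p i) with hd | hd | hd <;> rw [hd]
      · rw [if_pos rfl, walk_zero_dir]
      · rw [if_neg hr₀, if_pos rfl]
      · rw [if_neg hr₁, if_neg hr₂, hrv]
  -- If `x ≠ v`, the stranded group goes back to `u` and ends at `x'`, and the agents at `v` go to
  -- `u` in direction `r` and end at `z`. If `x = v`, nobody moves, and `z = x' = v`.
  set d₂ : Fin k → SignType := fun i =>
    if q₁ i = v then if x = v then 0 else r else -splitDir g X.ids p i with hd₂
  have hdec₁ := fun i => show decision k g (X.ids i) 1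
      { m i with
        clock := stageStart n j 1
        role := roles g X.ids p v i
        dir := splitDir g X.ids p i }
      (crewOf X (fun i => (m i).role) p (q₁ i))
      (crewOf X (roles g X.ids p v) q₁ (q₁ i)) = some
        { m i with
          clock := stageStart n j 1
          role := roles g X.ids p v i
          dir := d₂ i } by
    rw [decision, if_neg one_ne_zero, if_pos rfl, card_crewOf]
    simp only [h.low_iff hk, hd₂]
    by_cases hi : q₁ i = v
    · simp only [hi, if_true]
      rw [missingDir_eq X h hk hr hF₁]
    · simp only [hi, if_false]
  obtain ⟨hm₂, -, hw₂⟩ := stage_walk X (p := 1) (by omega) (by simp only [Nat.reduceAdd]; omega)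
    hm hm₁ hdec₁ (w := u)
    (Or.inr fun y => by
      rw [Halt, if_neg one_ne_zero, if_pos rfl, card_crewOf]; exact h.high_iff hk y)
  simp only [Nat.reduceAdd, ← hq₁] at hm₂ hw₂
  set e₂ : ℕ → Option (ZMod n) := fun τ => X.missing (stageStart n j 1 + 2 + τ)
  set q₂ := locAt X g (stageStart n j 2) with hq₂
  obtain ⟨z, x', hF₂, hzx⟩ : ∃ z x', Formation g X.ids p v r q₂ u z x' ∧
      (x' = z ∨ z = u ∨ x' = u) := by
    by_cases hxv : x = v
    · refine ⟨v, v, fun i => ?_, Or.inl rfl⟩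
      rw [hw₂ i, hd₂]
      dsimp only
      rw [hF₁ i, hxv]
      by_cases hi : p i = v
      · simp only [hi, if_true, walk_zero_dir]
      · rcases signType_cases hr (splitDir g X.ids p i) with hd | hd | hd <;>
          simp [hd, hi, hr₀, h.ne, hr₂, walk_zero_dir, walk_self]
    · refine ⟨walk e₂ u r v n, walk e₂ u (-r) x n, fun i => ?_,
        Or.inr (returning_arrives hn e₁ e₂ h.ne hr n)⟩
      rw [hw₂ i, hd₂]
      dsimp only
      rw [hF₁ i]
      by_cases hi : p i = v
      · simp only [hi, if_true, hxv, if_false]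
      · rcases signType_cases hr (splitDir g X.ids p i) with hd | hd | hd
        · simp [hd, hi, h.ne, walk_zero_dir]
        · simp [hd, hi, hr₀, hxv]
        · simp [hd, hi, hr₀, hr₂, hxv]
  -- If the agents from `v` are at `u` without the stranded group, everyone at `u` walks to `x'`.
  -- Otherwise nobody moves.
  have hnone := none_mem_roles X h hF₂
  have hmiss := missingDir_eq X h hk hr hF₂
  set d₃ : Fin k → SignType := fun i =>
    if q₂ i = u ∧ z = u ∧ x' ≠ u then if roles g X.ids p v i = some 0 then r else -r else 0 with hd₃
  have hdec₂ := fun i => show decision k g (X.ids i) 2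
      { m i with
        clock := stageStart n j 2
        role := roles g X.ids p v i
        dir := d₂ i }
      (crewOf X (fun i => (m i).role) p (q₂ i))
      (crewOf X (roles g X.ids p v) q₂ (q₂ i)) = some
        { m i with
          clock := stageStart n j 2
          role := roles g X.ids p v i
          dir := d₃ i } by
    rw [decision, if_neg two_ne_zero, if_neg (by decide), card_crewOf]
    simp only [h.high_iff hk, hd₃, hnone]
    by_cases hi : q₂ i = u
    · by_cases hz : z = u
      · rw [hz] at hmiss
        by_cases hx' : x' = u
        · simp [hi, hz, hmiss, hx']
        · simp [hi, hz, hmiss, hx']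
      · simp [hi, hz, Ne.symm hz]
    · simp [hi]
  have hstage := fun hw => stage_walk X (p := 2) (by omega) hT hm hm₂ hdec₂ (w := x') hw
  have hhalt : ∀ y, z = u → x' ≠ u → (Halt g 2 (crewOf X (fun i => (m i).role) p y)
      (crewOf X (roles g X.ids p v) q₂ y) ↔ y = x') := by
    intro y hz hx'
    rw [Halt, if_neg two_ne_zero, if_neg (by decide), hnone, hz]
    constructor
    · rintro ⟨h₁, h₂⟩
      rw [← Finset.card_pos, card_crewOf, agentsAt_pos_iff] at h₁
      obtain ⟨i, rfl⟩ := h₁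
      have := hF₂ i
      rw [hz] at this
      split_ifs at this
      · exact absurd this h₂
      · exact absurd this h₂
      · exact this
      · exact absurd this h₂
    · rintro rfl
      have := (dir_mem_roles X h hk hr hF₂ y).2 rfl
      exact ⟨(Finset.image_nonempty).1 ⟨_, this⟩, hx'⟩
  obtain ⟨hm₃, -, hw₃⟩ := hstage (by
    by_cases hc : z = u ∧ x' ≠ u
    · exact Or.inr fun y => hhalt y hc.1 hc.2
    · exact Or.inl fun i => if_neg fun h' => hc h'.2)
  simp only [Nat.reduceAdd, ← hq₂] at hm₃ hw₃
  refine ⟨⟨_, hm₃⟩, ?_⟩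
  set e₃ : ℕ → Option (ZMod n) := fun τ => X.missing (stageStart n j 2 + 2 + τ)
  set q₃ := locAt X g (stageStart n j 3) with hq₃
  suffices ∃ a b c, Formation g X.ids p v r q₃ a b c ∧ (c = a ∨ c = b) by
    obtain ⟨a, b, c, hF₃, hc⟩ := this
    obtain ⟨h₁, h₂⟩ := hF₃.halve X h hk hr X.ids_injective hc
    exact ⟨⟨a, b, h₁⟩, h₂⟩
  by_cases hc : z = u ∧ x' ≠ u
  · refine ⟨walk e₃ x' r u n, walk e₃ x' (-r) u n, x', fun i => ?_, ?_⟩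
    · rw [hw₃ i, hd₃]
      dsimp only
      rw [hF₂ i, hc.1]
      by_cases hi : p i = v
      · simp [hi, hc.2, roles]
      · rcases signType_cases hr (splitDir g X.ids p i) with hd | hd | hd
        · simp [hd, hi, hc.2, roles]
        · simp [hd, hi, hr₀, hc.2, walk_self]
        · simp [hd, hi, hr₀, hr₂, hc.2, roles]
    · have := splitting_arrives hn e₃ u x'
      rcases hr with rfl | rfl
      · exact this.imp Eq.symm Eq.symm
      · rw [neg_neg]
        exact this.symm.imp Eq.symm Eq.symm
  · refine ⟨u, z, x', fun i => ?_, ?_⟩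
    · have hd : d₃ i = 0 := if_neg fun h' => hc h'.2
      rw [hw₃ i, hd, walk_zero_dir]
      exact hF₂ i
    · by_cases hz : z = u
      · exact Or.inl (by_contra fun hx' => hc ⟨hz, hx'⟩)
      · rcases hzx with h' | h' | h'
        · exact Or.inr h'
        · exact absurd h' hz
        · exact Or.inl h'

end Subphase

end PartialGathering

/-! ### All subphases, and the bounds -/

namespace PartialGathering

section Phases

variable {n k g : ℕ} (X : Scenario n k)

theorem stageStart_mono {j j' : ℕ} (h : j ≤ j') : stageStart n j 0 ≤ stageStart n j' 0 := by
  unfold stageStart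
  gcongr

theorem horizon_eq : horizon n g = stageStart n (Nat.log 2 g + 2) 0 := by
  unfold horizon stageStart
  ring

theorem stageStart_add (j : ℕ) : stageStart n j 0 + (3 * n + 6) = stageStart n (j + 1) 0 := by
  unfold stageStart
  ring

/-- The situation at the beginning of a subphase. As deficits are halved, the agents are active for
at most `log₂ g + 2` subphases. -/
def AtSubphase (g j : ℕ) : Prop :=
  (∃ a b, ∀ i, locAt X g (stageStart n j 0) i = a ∨ locAt X g (stageStart n j 0) i = b) ∧
  (((∀ i, stateAt X g (stageStart n j 0) i = none) ∧
      deficit g (locAt X g (stageStart n j 0)) = 0) ∨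
    (∃ m : Fin k → Memory, ∀ i, stateAt X g (stageStart n j 0) i = some (m i)) ∧
      2 ^ j * deficit g (locAt X g (stageStart n j 0)) ≤ g ∧ j ≤ Nat.log 2 g + 1)

theorem exists_lacking_of_deficit {p : Fin k → ZMod n} (hk : 2 * g + 1 ≤ k)
    (hab : ∃ a b, ∀ i, p i = a ∨ p i = b) (hd : deficit g p ≠ 0) : ∃ u v, Lacking g p u v := by
  rw [Ne, deficit_eq_zero_iff] at hd
  push Not at hd
  obtain ⟨i, hi⟩ := hd
  obtain ⟨a, b, hab⟩ := hab
  obtain ⟨u, hu⟩ := exists_lacking hab (by omega) (agentsAt_pos_iff.2 ⟨i, rfl⟩) hi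
  exact ⟨u, _, hu⟩

theorem stageStart_le_horizon {j : ℕ} (hj : j ≤ Nat.log 2 g + 1) :
    stageStart n (j + 1) 0 ≤ horizon n g := by
  rw [horizon_eq]
  exact stageStart_mono (by omega)

/-- Once the deficit is zero, nobody moves any more. -/
theorem finish_of_atSubphase {j : ℕ} (h : AtSubphase X g j)
    (hd : deficit g (locAt X g (stageStart n j 0)) = 0) :
    (∀ i, stateAt X g (stageStart n (j + 1) 0) i = none) ∧
      ∀ t, stageStart n j 0 ≤ t → locAt X g t = locAt X g (stageStart n j 0) := by
  have hadd := stageStart_add (n := n) j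
  rcases h.2 with ⟨hs, -⟩ | ⟨⟨m, hm⟩, -, hj⟩
  · exact ⟨(terminated_forever X hs (by omega)).1, fun t ht => (terminated_forever X hs ht).2⟩
  · have hT := stageStart_le_horizon (n := n) hj
    have hs₀ := stageStart_eq (n := n) j 1
    obtain ⟨h₁, h₂, h₃⟩ := subphase_finish X (by omega) hm hd
    refine ⟨(terminated_forever X h₁ (by omega)).1, fun t ht => ?_⟩
    obtain rfl | rfl | ht' : t = stageStart n j 0 ∨ t = stageStart n j 0 + 1 ∨
      stageStart n j 0 + 2 ≤ t := by omega
    · rfl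
    · exact h₂
    · rw [(terminated_forever X h₁ ht').2, h₃]

theorem active_of_deficit {j : ℕ} (h : AtSubphase X g j)
    (hd : deficit g (locAt X g (stageStart n j 0)) ≠ 0) :
    (∃ m : Fin k → Memory, ∀ i, stateAt X g (stageStart n j 0) i = some (m i)) ∧
      2 ^ j * deficit g (locAt X g (stageStart n j 0)) ≤ g ∧ j ≤ Nat.log 2 g + 1 :=
  h.2.resolve_left fun h' => hd h'.2

theorem atSubphase_succ [NeZero n] (hn : 2 ≤ n) (hk : 2 * g + 1 ≤ k) {j : ℕ}
    (h : AtSubphase X g j) : AtSubphase X g (j + 1) := by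
  by_cases hd : deficit g (locAt X g (stageStart n j 0)) = 0
  · obtain ⟨h₁, h₂⟩ := finish_of_atSubphase X h hd
    have h₃ := h₂ _ (stageStart_mono (Nat.le_succ j))
    exact ⟨h₃ ▸ h.1, Or.inl ⟨h₁, h₃ ▸ hd⟩⟩
  · obtain ⟨⟨m, hm⟩, h₁, h₂⟩ := active_of_deficit X h hd
    obtain ⟨u, v, huv⟩ := exists_lacking_of_deficit hk h.1 hd
    obtain ⟨-, -, h₃, h₄, h₅⟩ := subphase_split X hn hk (stageStart_le_horizon h₂) hm huv
    refine ⟨h₄, Or.inr ⟨h₃, ?_, ?_⟩⟩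
    · rw [pow_succ, mul_assoc]
      exact (Nat.mul_le_mul_left _ h₅).trans h₁
    · refine Nat.succ_le_succ (Nat.le_log_of_pow_le one_lt_two ?_)
      exact (Nat.le_mul_of_pos_right _ (Nat.pos_of_ne_zero hd)).trans h₁

theorem atSubphase [NeZero n] (hn : 2 ≤ n) (hk : 2 * g + 1 ≤ k) (j : ℕ) : AtSubphase X g j := by
  induction j with
  | zero =>
    have h₀ : stageStart n 0 0 = prelude n := by simp [stageStart]
    unfold AtSubphase
    rw [h₀]
    rcases (selection X (g := g) hn (by omega)).2 with ⟨h₁, h₂⟩ | ⟨h₁, h₂⟩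
    · obtain ⟨h₃, h₄⟩ := terminated_forever X h₁ (t' := prelude n) (by unfold prelude; omega)
      rw [h₄]
      refine ⟨⟨_, 0, fun i => Or.inl (h₂ i ⟨0, by omega⟩)⟩, Or.inl ⟨h₃, ?_⟩⟩
      refine deficit_eq_zero_iff.2 fun i => ?_
      rw [agentsAt_eq_iff.2 fun i' => h₂ i' i]
      omega
    · refine ⟨h₂, Or.inr ⟨h₁, ?_, Nat.zero_le _⟩⟩
      rw [pow_zero, one_mul]
      exact Finset.sup_le fun i _ => Nat.sub_le _ _
  | succ j ih => exact atSubphase_succ X hn hk ih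

theorem splittingPhase [NeZero n] (hn : 2 ≤ n) (hk : 2 * g + 1 ≤ k) :
    SplittingPhase (splitting n k g) X g (prelude n) 2 (3 * n + 6) := by
  have hstart : ∀ j, prelude n + j * (3 * n + 6) = stageStart n j 0 := fun j => by
    unfold stageStart; ring
  have hat := atSubphase X (g := g) hn hk
  refine ⟨by omega, fun j => ?_, fun j => ?_, fun j => ?_, fun j v => ?_, fun j => ?_⟩
  · rw [hstart]
    exact (hat j).1
  · rw [hstart, hstart]
    exact finish_of_atSubphase X (hat j)
  · rw [hstart]
    intro t ht ht'
    by_cases hd : deficit g (locAt X g (stageStart n j 0)) = 0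
    · have h := (finish_of_atSubphase X (hat j) hd).2
      exact (h _ (ht.trans t.le_succ)).trans (h t ht).symm
    · obtain ⟨⟨m, hm⟩, -, hj⟩ := active_of_deficit X (hat j) hd
      obtain ⟨u, v, huv⟩ := exists_lacking_of_deficit hk (hat j).1 hd
      obtain ⟨⟨h₁, h₂⟩, -⟩ := subphase_split X hn hk (stageStart_le_horizon hj) hm huv
      obtain rfl | rfl : t = stageStart n j 0 ∨ t = stageStart n j 0 + 1 := by omega
      · exact h₁
      · exact h₂.trans h₁.symm
  · rw [hstart]
    intro hpos hlt
    have hd : deficit g (locAt X g (stageStart n j 0)) ≠ 0 := by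
      intro hd
      obtain ⟨i, rfl⟩ := agentsAt_pos_iff.1 hpos
      exact absurd (deficit_eq_zero_iff.1 hd i) (not_le.2 hlt)
    obtain ⟨⟨m, hm⟩, -, hj⟩ := active_of_deficit X (hat j) hd
    obtain ⟨a, b, hab⟩ := (hat j).1
    obtain ⟨u, huv⟩ := exists_lacking hab (by omega) hpos hlt
    exact (subphase_split X hn hk (stageStart_le_horizon hj) hm huv).2.1
  · rw [hstart, hstart]
    change 2 * deficit g (locAt X g _) ≤ deficit g (locAt X g _)
    by_cases hd : deficit g (locAt X g (stageStart n j 0)) = 0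
    · rw [(finish_of_atSubphase X (hat j) hd).2 _ (stageStart_mono j.le_succ), hd]
    · obtain ⟨⟨m, hm⟩, -, hj⟩ := active_of_deficit X (hat j) hd
      obtain ⟨u, v, huv⟩ := exists_lacking_of_deficit hk (hat j).1 hd
      exact (subphase_split X hn hk (stageStart_le_horizon hj) hm huv).2.2.2.2

theorem gathered_at_horizon [NeZero n] (hn : 2 ≤ n) (hk : 2 * g + 1 ≤ k) :
    (splitting n k g).Terminated X (horizon n g) ∧
      PartiallyGathered g ((splitting n k g).loc X (horizon n g)) := by
  have hat := atSubphase X (g := g) hn hk (Nat.log 2 g + 1)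
  have hd : deficit g (locAt X g (stageStart n (Nat.log 2 g + 1) 0)) = 0 := by
    by_contra hd
    obtain ⟨-, h, -⟩ := active_of_deficit X hat hd
    have := (Nat.le_mul_of_pos_right _ (Nat.pos_of_ne_zero hd)).trans h
    exact absurd (Nat.lt_pow_succ_log_self one_lt_two g) (not_lt.2 this)
  obtain ⟨h₁, h₂⟩ := finish_of_atSubphase X hat hd
  rw [horizon_eq]
  refine ⟨h₁, ?_⟩
  have h₃ := h₂ _ (stageStart_mono (Nat.le_succ _))
  rintro v ⟨i, rfl⟩
  change g ≤ agentsAt (locAt X g _) (locAt X g _ i)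
  rw [h₃]
  exact deficit_eq_zero_iff.1 hd i

/-- The constant comes from `log g ≥ 1`, `log₂ g ≤ 3 / 2 * log g` and `3 * (n + 2) ≤ 4 * n`. -/
theorem horizon_le {n g : ℕ} (hn : 7 ≤ n) (hg : 3 ≤ g) :
    (horizon n g : ℝ) ≤ 21 * (n * Real.log g) := by
  have hg' : (3 : ℝ) ≤ g := by exact_mod_cast hg
  have hn' : (7 : ℝ) ≤ n := by exact_mod_cast hn
  have hlog : 1 ≤ Real.log g := by
    rw [Real.le_log_iff_exp_le (by linarith)]
    have := Real.exp_one_lt_d9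
    linarith
  have hlog₂ : (Nat.log 2 g : ℝ) ≤ 3 / 2 * Real.log g := by
    have h₁ : ((2 : ℝ) ^ Nat.log 2 g) ≤ g := by
      exact_mod_cast Nat.pow_log_le_self 2 (by omega)
    have h₂ := Real.log_le_log (by positivity) h₁
    rw [Real.log_pow] at h₂
    have h₃ := Real.log_two_gt_d9
    have h₄ : (0 : ℝ) ≤ Nat.log 2 g := Nat.cast_nonneg _
    nlinarith
  unfold horizon prelude
  push_cast
  have h₅ : (Nat.log 2 g + 2 : ℝ) ≤ 7 / 2 * Real.log g := by linarith
  have h₆ : (3 * (n + 2) : ℝ) ≤ 4 * n := by linarith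
  have h₇ := mul_le_mul h₅ h₆ (by positivity) (by positivity)
  have h₈ : (n : ℝ) ≤ n * Real.log g := le_mul_of_one_le_right (by positivity) hlog
  linarith

theorem sum_moves_le (A : Algorithm) (T : ℕ) : ∑ i, A.moves X T i ≤ k * T := by
  refine (Finset.sum_le_card_nsmul _ _ T fun i _ => ?_).trans_eq (by simp)
  exact (Finset.card_filter_le _ _).trans_eq (Finset.card_range T)

end Phases

end PartialGathering

theorem theorem4 :
    ∃ C : ℝ, 0 < C ∧ ∀ n k g : ℕ, 2 * g + 1 ≤ k → k + 2 ≤ 3 * g → k ≤ n →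
      ∃ A : Algorithm, A.IsFinite ∧
        (∀ X : Scenario n k,
          SolvesWithin A X g (C * (n * Real.log g)) (C * (g * n * Real.log g))) ∧
        ∃ S s L : ℕ, (S : ℝ) ≤ C * n ∧ (L : ℝ) ≤ C * n ∧
          ∀ X : Scenario n k, SelectionPhase A X S ∧ SplittingPhase A X g (S + 3 * n) s L := by
  refine ⟨63, by norm_num, fun n k g hk hk' hkn => ?_⟩
  have hg : 3 ≤ g := by omega
  have hn : 7 ≤ n := by omega
  have : NeZero n := ⟨by omega⟩
  have hn' : (7 : ℝ) ≤ n := by exact_mod_cast hn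
  have hT := PartialGathering.horizon_le hn hg
  have hT₀ : (0 : ℝ) ≤ PartialGathering.horizon n g := Nat.cast_nonneg _
  refine ⟨PartialGathering.splitting n k g, PartialGathering.splitting_isFinite n k g,
    fun X => ?_, 3 * n + 2, 2, 3 * n + 6, ?_, ?_, fun X => ⟨?_, ?_⟩⟩
  · obtain ⟨h₁, h₂⟩ := PartialGathering.gathered_at_horizon X (g := g) (by omega) hk
    refine ⟨PartialGathering.horizon n g, by linarith, h₁, h₂, ?_⟩
    have h₃ : ((∑ i, (PartialGathering.splitting n k g).moves X
        (PartialGathering.horizon n g) i : ℕ) : ℝ) ≤ k * PartialGathering.horizon n g := by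
      exact_mod_cast PartialGathering.sum_moves_le X _ _
    have h₄ : (k : ℝ) ≤ 3 * g := by exact_mod_cast (by omega : k ≤ 3 * g)
    calc _ ≤ (k : ℝ) * PartialGathering.horizon n g := h₃
      _ ≤ 3 * g * (21 * (n * Real.log g)) := mul_le_mul h₄ hT hT₀ (by positivity)
      _ = 63 * (g * n * Real.log g) := by ring
  · push_cast
    linarith
  · push_cast
    linarith
  · exact (PartialGathering.selection X (by omega) (by omega)).1
  · rw [show 3 * n + 2 + 3 * n = PartialGathering.prelude n by
      unfold PartialGathering.prelude; omega]
    exact PartialGathering.splittingPhase X (by omega) hk
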